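/- **Parking on random recursive trees.** Let $(\mathbb T_n)_{n\ge 1}$ be the increasing sequence of random recursive trees: $\mathbb T_1$ consists of the root $1$ only, and for $n\ge 2$ the tree $\mathbb T_n$ is obtained from $\mathbb T_{n-1}$ by attaching the vertex $n$ to a vertex chosen uniformly in $\{1,\dots,n-1\}$, independently of the past (so $\mathbb T_n$ is uniform among the $(n-1)!$ recursive trees of size $n$). For a probability law $\mu$ on $\{0,1,2,\dots\}$, let the numbers of cars arriving at the vertices $1,2,\dots$ be i.i.d. with law $\mu$ and independent of the trees. Each car arriving at a vertex of $\mathbb T_n$ parks at the first free vertex on the path from its arrival vertex to the root, and exits the tree if there is none. Let $\varphi(\mathbb T_n,\mu)$ be the number of cars that exit $\mathbb T_n$ (it does not depend on the order in which the cars arrive; $\varphi(\mathbb T_0,\mu)=0$), and for $C>0$ let $\theta(\mu,C)=\inf\{n\ge 0:\varphi(\mathbb T_n,\mu)\ge C\}\in\mathbb N\cup\{\infty\}$. Let $(\mu_\alpha:\alpha\in[0,1])$ be a stochastically increasing family of probability laws on $\{0,1,2,\dots\}$ such that * $\mu_\alpha$ has mean $\alpha$ for every $\alpha\in[0,1]$;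 * $\mu_\alpha(\{0,1\})<1$ for every $\alpha\in(0,1]$; * there is an integer $K$ such that $\mu_\alpha(\{0,\dots,K\})=1$ for every $\alpha\in[0,1]$; * for every $1\le k\le K$, either $\mu_\alpha(\{k\})=0$ for all sufficiently small $\alpha>0$, in which case $C_k:=0$, or there are $C_k>0$ and $\beta_k\ge 1/k$ such that $\mu_\alpha(\{k\})\sim C_k\,\alpha^{\beta_k k}$ as $\alpha\to0$. Put $\beta^*=\inf\{\beta_k : 1\le k\le K,\ C_k>0\}$. Then, writing $u_n\ll v_n$ (or $v_n\gg u_n$) for $u_n/v_n\to0$ as $n\to\infty$, for every $\delta>0$ and every sequence $(\alpha_n)$ in $[0,1]$, $$\varphi(\mathbb T_n,\mu_{\alpha_n})\xrightarrow[n\to\infty]{(\mathbb P)}\begin{cases}0&\text{if }\alpha_n\ll \log(n)^{-1/\beta^*},\\ +\infty&\text{if }\alpha_n\gg\log(n)^{-1/\beta^*+\delta}.\end{cases}$$ Moreover, for every $C>0$, $$\frac{\log\log\theta(\mu_\alpha,C)}{|\log\alpha|}\xrightarrow[\alpha\to0]{(\mathbb P)}\beta^*,$$ where $\log\log 1=-\infty$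 and $\log\log\infty=\infty$. -/

import Mathlib

open MeasureTheory Filter Topology
open scoped ENNReal Asymptotics

namespace Parking

/-! ### Recursive trees

Vertices are numbered from `0`, so that the vertex called `v` here carries the label `v + 1`. -/

/-- An infinite attachment sequence: `t v ≤ v` is the parent of the vertex `v + 1`, and `0` is the
root. Such a sequence is an increasing sequence of recursive trees: the tree of size `n` is its
restriction to the vertices `0, …, n - 1`, and all recursive trees of size `n` arise, each of them
from exactly one choice of `t 0, …, t (n - 2)`. -/
abbrev Attachment : Type := (v : ℕ) → Fin (v + 1)

/-! ### Parking on a fixed recursive tree -/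

/-- The place where a car that arrives at a given vertex parks when the vertices in `S` are
occupied: the first free vertex on the path to the root, or `none` if there is none, in which case
the car exits the tree. -/
def spot (t : Attachment) (S : Finset ℕ) : ℕ → Option ℕ
  | 0 => if 0 ∈ S then none else some 0
  | v + 1 => if v + 1 ∈ S then spot t S (t v) else some (v + 1)
decreasing_by exact (t v).isLt

/-- The effect of one car arriving at `v`. A state consists of the set of occupied vertices and of
the number of cars that have exited through the root. -/
def arrive (t : Attachment) (s : Finset ℕ × ℕ) (v : ℕ) : Finset ℕ × ℕ :=
  match spot t s.1 v with
  | none => (s.1, s.2 + 1)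
  | some w => (insert w s.1, s.2)

/-- The final state when cars arrive one after the other at the vertices listed in `l`, the tree
being empty at the beginning. -/
def park (t : Attachment) (l : List ℕ) : Finset ℕ × ℕ :=
  l.foldl (arrive t) (∅, 0)

/-- The cars that arrive on the tree of size `n`: `x v` cars arrive at the vertex `v`. -/
def cars (n : ℕ) (x : ℕ → ℕ) : List ℕ :=
  (List.range n).flatMap fun v => List.replicate (x v) v

/-- The flux of cars that exit the tree of size `n` when `x v` cars arrive at the vertex `v`.
By `park_snd_eq_flux` below, the order of the arrivals does not matter. -/
def flux (t : Attachment) (n : ℕ) (x : ℕ → ℕ) : ℕ :=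
  (park t (cars n x)).2

theorem spot_insert_of_ne (t : Attachment) (S : Finset ℕ) (w v : ℕ) (h : spot t S v ≠ some w) :
    spot t (insert w S) v = spot t S v := by
  induction v using Nat.strong_induction_on with
  | _ v ih =>
    cases v with
    | zero =>
      unfold spot at h ⊢
      by_cases h0 : 0 ∈ S <;> simp_all
    | succ v =>
      unfold spot at h ⊢
      by_cases h0 : v + 1 ∈ S
      · simp only [h0, if_true, Finset.mem_insert, or_true] at h ⊢
        exact ih _ (t v).isLt h
      · simp_all

theorem spot_insert_of_eq (t : Attachment) (S : Finset ℕ) (w v : ℕ) (h : spot t S v = some w) :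
    spot t (insert w S) v = spot t (insert w S) w := by
  induction v using Nat.strong_induction_on with
  | _ v ih =>
    cases v with
    | zero =>
      unfold spot at h
      by_cases h0 : 0 ∈ S <;> simp_all
    | succ v =>
      unfold spot at h
      by_cases h0 : v + 1 ∈ S
      · simp only [h0, if_true] at h
        conv_lhs => unfold spot
        simp only [h0, if_true, Finset.mem_insert, or_true]
        exact ih _ (t v).isLt h
      · simp only [h0, if_false, Option.some.injEq] at h
        rw [h]

/-- Two consecutive arrivals may be exchanged. -/
theorem arrive_comm (t : Attachment) (s : Finset ℕ × ℕ) (u v : ℕ) :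
    arrive t (arrive t s u) v = arrive t (arrive t s v) u := by
  rcases hu : spot t s.1 u with _ | a <;> rcases hv : spot t s.1 v with _ | b
  · simp [arrive, hu, hv]
  · have h1 := spot_insert_of_ne t s.1 b u (by simp [hu])
    simp [arrive, hu, hv, h1]
  · have h1 := spot_insert_of_ne t s.1 a v (by simp [hv])
    simp [arrive, hu, hv, h1]
  · by_cases hab : a = b
    · subst hab
      have h1 := spot_insert_of_eq t s.1 a u hu
      have h2 := spot_insert_of_eq t s.1 a v hv
      simp [arrive, hu, hv, h1, h2]
    · have h1 := spot_insert_of_ne t s.1 a v (by simpa [hv] using Ne.symm hab)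
      have h2 := spot_insert_of_ne t s.1 b u (by simpa [hu] using hab)
      simp [arrive, hu, hv, h1, h2, Finset.insert_comm]

/-- The final configuration, and in particular the flux, does not depend on the order in which the
cars arrive. -/
theorem park_perm (t : Attachment) {l l' : List ℕ} (h : l.Perm l') : park t l = park t l' :=
  h.foldl_eq' (fun u _ v _ s => arrive_comm t s u v) _

theorem park_snd_eq_flux (t : Attachment) (n : ℕ) (x : ℕ → ℕ) (l : List ℕ)
    (h : l.Perm (cars n x)) : (park t l).2 = flux t n x := by
  rw [park_perm t h, flux]

/-- The time of appearance of a flux at least `c`, with the value `⊤` if this never happens. -/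
noncomputable def appearanceTime (t : Attachment) (x : ℕ → ℕ) (c : ℝ) : ℕ∞ :=
  sInf ((fun n : ℕ => (n : ℕ∞)) '' {n : ℕ | c ≤ (flux t n x : ℝ)})

/-- `log (log θ)`, with its natural values in `[-∞, ∞]`: `log (log 1) = -∞` and `log (log ∞) = ∞`.
(Appearance times of a positive flux are at least `1`, so that `log θ ≥ 0`.) -/
noncomputable def logLog (θ : ℕ∞) : EReal :=
  ENNReal.log (ENNReal.log (θ : ℝ≥0∞)).toENNReal

/-! ### Random recursive trees and random arrivals -/

/-- The law of the increasing sequence of random recursive trees: each new vertex is attached to a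
uniform vertex among the preceding ones, independently of the past. The tree of size `n` is then
uniform among the recursive trees of size `n`. -/
noncomputable def treeLaw : Measure Attachment :=
  Measure.infinitePi fun v : ℕ => (PMF.uniformOfFintype (Fin (v + 1))).toMeasure

/-- The joint law of the increasing sequence of random recursive trees and of the numbers of cars
arriving at the vertices, which are independent of the trees and i.i.d. with law `μ`. -/
noncomputable def parkingLaw (μ : PMF ℕ) : Measure (Attachment × (ℕ → ℕ)) :=
  treeLaw.prod (Measure.infinitePi fun _ : ℕ => μ.toMeasure)

/-- The assumptions on the family of laws `μ α`, `α ∈ [0, 1]`, of car arrivals. (The values of `μ`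
outside `[0, 1]` play no role, neither do `C k` and `β k` for `k` outside `{1, …, K}`, nor does
`β k` if `C k = 0`.) -/
structure IsArrivalFamily (μ : ℝ → PMF ℕ) (K : ℕ) (C β : ℕ → ℝ) : Prop where
  /-- the family is stochastically increasing -/
  mono : ∀ α ∈ Set.Icc (0 : ℝ) 1, ∀ α' ∈ Set.Icc (0 : ℝ) 1, α ≤ α' →
    ∀ k : ℕ, (μ α).toMeasure (Set.Ici k) ≤ (μ α').toMeasure (Set.Ici k)
  /-- the law `μ α` has mean `α` -/
  mean : ∀ α ∈ Set.Icc (0 : ℝ) 1, ∑' k : ℕ, (k : ℝ≥0∞) * μ α k = ENNReal.ofReal α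
  /-- with positive probability at least two cars arrive at a vertex -/
  nontrivial : ∀ α ∈ Set.Ioc (0 : ℝ) 1, (μ α).toMeasure {0, 1} < 1
  /-- at most `K` cars arrive at a vertex -/
  bounded : ∀ α ∈ Set.Icc (0 : ℝ) 1, (μ α).toMeasure (Set.Iic K) = 1
  /-- the asymptotics of `μ α k` as `α → 0` -/
  asymp : ∀ k : ℕ, 1 ≤ k → k ≤ K →
    (C k = 0 ∧ ∀ᶠ α in 𝓝[>] (0 : ℝ), μ α k = 0) ∨
    (0 < C k ∧ 1 / (k : ℝ) ≤ β k ∧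
      (fun α : ℝ => (μ α k).toReal) ~[𝓝[>] (0 : ℝ)] fun α : ℝ => C k * α ^ (β k * (k : ℝ)))

/-- `β* = inf {β k : 1 ≤ k ≤ K, C k > 0}`. -/
noncomputable def betaStar (K : ℕ) (C β : ℕ → ℝ) : ℝ :=
  sInf (β '' {k : ℕ | 1 ≤ k ∧ k ≤ K ∧ 0 < C k})

end Parking

/-!
Let `b` be the exponent `betaStar`.

*The flux as a maximum.* The flux is at least `c ≥ 1` if and only if some rooted subtree contains
at least `c` more cars than vertices: a rooted subtree retains at most one car per vertex
(`ParentClosed.sum_le`), and the root component of the set of finally occupied vertices attains the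
flux (`exists_parentClosed_of_flux_pos`).

*No flux below the window.* In the recursive tree of size `n` the expected number of rooted
subtrees with `k + 1` vertices is at most `(log n + 1) ^ k` (`sum_subtreeWeight_le`). For
`z = α ^ (-b)` the generating function of `μ α` at `z` remains bounded by a constant `A` as
`α → 0`, because `μ α k` is of order at most `α ^ (b * k)`; by the exponential Markov inequality a
set of `k + 1` vertices receives `k + 2` cars with probability at most
`A ^ (k + 1) * z ^ (-(k + 2))`. The union bound is thus a geometric series of ratio of order
`α ^ b * log n` (`parkingLaw_flux_pos_le`, `IsArrivalFamily.exists_flux_pos_le`).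

*Flux above the window.* Here chains suffice instead of general subtrees. Let `k` satisfy
`β k = b`, and consider chains descending from the root that consist of `g` groups of `k` vertices,
with `k` cars on the last vertex of each group, and of one further vertex with at least two cars.
Such a chain carries more cars than it has non-root vertices. If its vertices are taken in
successive ranges of labels which are intervals of equal length on the scale of `log`, a vertex has
of order `log n` children in the next range. Each group then multiplies the expected number of
chains by a quantity of order `(log n) ^ k * α ^ (b * k)`, which is at least of order
`α ^ (-δ * k)` for some `δ > 0`, and with `g` large this compensates the cost of the last
vertex. So the expected sizes of all levels of this process of chains are large. Exposing the
vertices one at a time (`lintegral_expose_le`) gives a recursion for the Laplace transform of the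
sizes of the levels, from which the probability that there is no chain is at most the sum of the
inverses of these expected sizes (`parkingLaw_level_empty_le`). Chains in disjoint ranges of labels
add up to an arbitrarily large flux (`parkingLaw_flux_lt_le`,
`IsArrivalFamily.exists_flux_lt_le`). Only lower bounds for the tails of the arrivals enter, so
stochastic monotonicity extends the conclusion to all larger densities.

*The appearance time.* The flux is nondecreasing in `n`, hence the appearance time is controlled by
the two regimes at the sizes `exp (α ^ (-y))` with `y` slightly below and slightly above `b`.
-/

namespace Parking

/-! ### The flux as a maximal excess over rooted subtrees -/

/-- A set of vertices is closed under taking parents. If it contains the root, it is a rooted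
subtree. -/
def ParentClosed (t : Attachment) (S : Finset ℕ) : Prop :=
  ∀ v : ℕ, v + 1 ∈ S → (t v : ℕ) ∈ S

theorem spot_notMem (t : Attachment) (O : Finset ℕ) (v w : ℕ) (h : spot t O v = some w) :
    w ∉ O := by
  induction v using Nat.strong_induction_on with
  | _ v ih =>
    cases v with
    | zero =>
      unfold spot at h
      split_ifs at h
      simp_all
    | succ v =>
      unfold spot at h
      split_ifs at h with h0
      · exact ih _ (t v).isLt h
      · simp_all

theorem ParentClosed.spot_mem {t : Attachment} {S : Finset ℕ} (hS : ParentClosed t S)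
    (O : Finset ℕ) (v w : ℕ) (hv : v ∈ S) (h : spot t O v = some w) : w ∈ S := by
  induction v using Nat.strong_induction_on with
  | _ v ih =>
    cases v with
    | zero =>
      unfold spot at h
      split_ifs at h
      simp_all
    | succ v =>
      unfold spot at h
      split_ifs at h with h0
      · exact ih _ (t v).isLt (hS v hv) h
      · simp_all

theorem mem_of_spot_eq_none {t : Attachment} {O : Finset ℕ} {v : ℕ} (h : spot t O v = none) :
    v ∈ O := by
  cases v <;> unfold spot at h <;> split_ifs at h <;> assumption

theorem spot_parent_eq_none {t : Attachment} {O : Finset ℕ} {v : ℕ}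
    (h : spot t O (v + 1) = none) : spot t O (t v) = none := by
  unfold spot at h
  split_ifs at h
  exact h

theorem spot_zero_eq_none {t : Attachment} {O : Finset ℕ} {v : ℕ}
    (h : spot t O v = none) : spot t O 0 = none := by
  induction v using Nat.strong_induction_on with
  | _ v ih =>
    cases v with
    | zero => exact h
    | succ v => exact ih _ (t v).isLt (spot_parent_eq_none h)

/-- A car that would meet a free vertex of `O` on its way parks, when fewer vertices are occupied,
at a vertex that is not in the root component of `O`. -/
theorem exists_spot_of_subset {t : Attachment} {O O' : Finset ℕ} (hO : O' ⊆ O) (v : ℕ)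
    (h : spot t O v ≠ none) : ∃ w, spot t O' v = some w ∧ spot t O w ≠ none := by
  induction v using Nat.strong_induction_on with
  | _ v ih =>
    by_cases hv : v ∈ O'
    · cases v with
      | zero => exact absurd (by unfold spot; simp [hO hv]) h
      | succ v =>
        have h' : spot t O (t v) ≠ none := by
          unfold spot at h
          simpa [hO hv] using h
        obtain ⟨w, hw, hw'⟩ := ih _ (t v).isLt h'
        refine ⟨w, ?_, hw'⟩
        unfold spot
        simpa [hv] using hw
    · refine ⟨v, ?_, h⟩
      cases v <;> unfold spot <;> simp [hv]

theorem park_append_singleton (t : Attachment) (l : List ℕ) (v : ℕ) :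
    park t (l ++ [v]) = arrive t (park t l) v := by
  simp [park]

theorem ParentClosed.countP_le {t : Attachment} {S : Finset ℕ} (hS : ParentClosed t S)
    (l : List ℕ) : l.countP (· ∈ S) ≤ ((park t l).1 ∩ S).card + (park t l).2 := by
  induction l using List.reverseRecOn with
  | nil => simp [park]
  | append_singleton l v ih =>
    rw [park_append_singleton, List.countP_append]
    rcases hs : spot t (park t l).1 v with _ | w
    · have : List.countP (· ∈ S) [v] ≤ 1 := List.countP_le_length
      simp only [arrive, hs]
      omega
    · have hw := spot_notMem t _ _ _ hs
      simp only [arrive, hs]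
      by_cases hv : v ∈ S
      · have hwS := hS.spot_mem _ _ _ hv hs
        rw [Finset.insert_inter_of_mem hwS, Finset.card_insert_of_notMem (by simp [hw])]
        have : List.countP (· ∈ S) [v] ≤ 1 := List.countP_le_length
        omega
      · have h1 : List.countP (· ∈ S) [v] = 0 := by simp [hv]
        have h2 : ((park t l).1 ∩ S).card ≤ (insert w (park t l).1 ∩ S).card :=
          Finset.card_le_card (Finset.inter_subset_inter_right (Finset.subset_insert _ _))
        omega

theorem park_fst_subset_arrive (t : Attachment) (s : Finset ℕ × ℕ) (v : ℕ) :
    s.1 ⊆ (arrive t s v).1 := by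
  rcases hs : spot t s.1 v with _ | w <;> simp [arrive, hs]

/-- Let `S` be the root component of a set `O` of vertices. As long as all occupied vertices
belong to `O`, the cars that have exited or are parked in `S` have all arrived in `S`. -/
theorem card_add_le_countP (t : Attachment) (O : Finset ℕ) (l : List ℕ)
    (hl : (park t l).1 ⊆ O) (S : Finset ℕ) (hS : ∀ v ∈ S, spot t O v = none)
    (hS' : ∀ v ∈ l, spot t O v = none → v ∈ S) :
    ((park t l).1 ∩ S).card + (park t l).2 ≤ l.countP (· ∈ S) := by
  induction l using List.reverseRecOn with
  | nil => simp [park]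
  | append_singleton l v ih =>
    rw [park_append_singleton] at hl ⊢
    have hsub := (park_fst_subset_arrive t (park t l) v).trans hl
    have ih' := ih hsub fun u hu => hS' u (by simp [hu])
    rw [List.countP_append]
    by_cases hv : spot t O v = none
    · have hvS := hS' v (by simp) hv
      have h1 : List.countP (· ∈ S) [v] = 1 := by simp [hvS]
      rcases hs : spot t (park t l).1 v with _ | w
      · simp only [arrive, hs]
        omega
      · simp only [arrive, hs]
        have h2 : (insert w (park t l).1 ∩ S).card ≤ ((park t l).1 ∩ S).card + 1 := by
          refine (Finset.card_le_card (t := insert w ((park t l).1 ∩ S)) ?_).trans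
            (Finset.card_insert_le _ _)
          intro x
          simp only [Finset.mem_inter, Finset.mem_insert]
          tauto
        omega
    · obtain ⟨w, hw, hw'⟩ := exists_spot_of_subset hsub v hv
      simp only [arrive, hw]
      have hwS : w ∉ S := fun h => hw' (hS w h)
      rw [Finset.insert_inter_of_notMem hwS]
      omega

theorem countP_cars (n : ℕ) (x : ℕ → ℕ) (S : Finset ℕ) (hS : S ⊆ Finset.range n) :
    (cars n x).countP (· ∈ S) = ∑ v ∈ S, x v := by
  have h : ∀ m : ℕ, (cars m x).countP (· ∈ S) = ∑ v ∈ Finset.range m, if v ∈ S then x v else 0 := by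
    intro m
    induction m with
    | zero => simp [cars]
    | succ m ih =>
      rw [Finset.sum_range_succ, ← ih]
      simp only [cars, List.range_succ, List.flatMap_append, List.countP_append,
        List.flatMap_singleton, List.countP_replicate]
      simp
  rw [h, ← Finset.sum_filter]
  congr 1
  ext v
  simp only [Finset.mem_filter]
  exact ⟨fun h => h.2, fun h => ⟨hS h, h⟩⟩

theorem ParentClosed.sum_le {t : Attachment} {S : Finset ℕ} (hS : ParentClosed t S) {n : ℕ}
    (hn : S ⊆ Finset.range n) (x : ℕ → ℕ) : ∑ v ∈ S, x v ≤ S.card + flux t n x := by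
  rw [← countP_cars n x S hn]
  refine (hS.countP_le _).trans ?_
  exact Nat.add_le_add_right (Finset.card_le_card Finset.inter_subset_right) _

theorem park_snd_pos {t : Attachment} (l : List ℕ) (h : 0 < (park t l).2) :
    spot t (park t l).1 0 = none := by
  induction l using List.reverseRecOn with
  | nil => simp [park] at h
  | append_singleton l v ih =>
    rw [park_append_singleton] at h ⊢
    rcases hs : spot t (park t l).1 v with _ | w
    · simpa only [arrive, hs] using spot_zero_eq_none hs
    · simp only [arrive, hs] at h ⊢
      have h0 := ih h
      unfold spot at h0 ⊢
      split_ifs at h0 with h1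
      simp [h1]

/-- A positive flux is attained as the excess of cars over vertices in a rooted subtree, namely in
the root component of the set of vertices that are occupied at the end. -/
theorem exists_parentClosed_of_flux_pos {t : Attachment} {n : ℕ} {x : ℕ → ℕ}
    (h : 0 < flux t n x) :
    ∃ S ⊆ Finset.range n, 0 ∈ S ∧ ParentClosed t S ∧ S.card + flux t n x ≤ ∑ v ∈ S, x v := by
  classical
  set O := (park t (cars n x)).1 with hO
  have h0 : spot t O 0 = none := park_snd_pos _ h
  have hn : 0 < n := by
    rcases Nat.eq_zero_or_pos n with rfl | hn
    · simp [flux, cars, park] at h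
    · exact hn
  have hmem : ∀ v ∈ cars n x, v < n := by
    intro v hv
    simp only [cars, List.mem_flatMap, List.mem_range, List.mem_replicate] at hv
    obtain ⟨a, ha, -, rfl⟩ := hv
    exact ha
  set S := (Finset.range n).filter fun v => spot t O v = none with hS
  have hSO : S ⊆ O := fun v hv => mem_of_spot_eq_none (Finset.mem_filter.1 hv).2
  refine ⟨S, Finset.filter_subset _ _, by simp [hS, hn, h0], ?_, ?_⟩
  · intro v hv
    simp only [hS, Finset.mem_filter, Finset.mem_range] at hv ⊢
    exact ⟨by have := (t v).isLt; omega, spot_parent_eq_none hv.2⟩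
  · rw [← countP_cars n x S (Finset.filter_subset _ _)]
    have := card_add_le_countP t O (cars n x) subset_rfl S
      (fun v hv => (Finset.mem_filter.1 hv).2)
      (fun v hv h => by simp [hS, h, hmem v hv])
    rwa [← hO, Finset.inter_eq_right.2 hSO] at this

theorem flux_mono (t : Attachment) (x : ℕ → ℕ) : Monotone fun n => flux t n x := by
  intro n m hnm
  rcases Nat.eq_zero_or_pos (flux t n x) with h | h
  · simp [h]
  · obtain ⟨S, hS, -, hc, hle⟩ := exists_parentClosed_of_flux_pos h
    have := hc.sum_le (hS.trans (Finset.range_mono hnm)) x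
    dsimp only
    omega

/-! ### First moment bound for the number of rooted subtrees -/

instance : IsProbabilityMeasure treeLaw := by
  unfold treeLaw; infer_instance

instance (μ : PMF ℕ) : IsProbabilityMeasure (parkingLaw μ) := by
  unfold parkingLaw; infer_instance

/-- The set of vertices that consists of the root and of the vertices `v + 1`, `v ∈ V`. -/
def withRoot (V : Finset ℕ) : Finset ℕ := insert 0 (V.image (· + 1))

theorem card_withRoot (V : Finset ℕ) : (withRoot V).card = V.card + 1 := by
  rw [withRoot, Finset.card_insert_of_notMem (by simp),
    Finset.card_image_of_injective _ (add_left_injective 1)]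

/-- The probability that `withRoot V` is a rooted subtree: the parent of `v + 1` has to be chosen
among the elements of `withRoot V` that are at most `v`. -/
noncomputable def subtreeWeight (V : Finset ℕ) : ℝ≥0∞ :=
  ∏ v ∈ V, (((V.filter (· < v)).card + 1 : ℕ) : ℝ≥0∞) / ((v + 1 : ℕ) : ℝ≥0∞)

theorem treeLaw_parentClosed_le (V : Finset ℕ) :
    treeLaw {t | ParentClosed t (withRoot V)} ≤ subtreeWeight V := by
  have hsub : {t : Attachment | ParentClosed t (withRoot V)} ⊆
      Set.pi (V : Set ℕ) (fun v => {i : Fin (v + 1) | (i : ℕ) ∈ withRoot V}) := by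
    intro t ht v hv
    exact ht v (by simpa [withRoot] using hv)
  refine (measure_mono hsub).trans ?_
  rw [treeLaw, Measure.infinitePi_pi _ (fun _ _ => MeasurableSet.of_discrete), subtreeWeight]
  refine Finset.prod_le_prod' fun v _ => ?_
  rw [PMF.toMeasure_uniformOfFintype_apply _ MeasurableSet.of_discrete, Fintype.card_fin]
  gcongr
  rw [Fintype.card_subtype]
  have h : (Finset.univ.filter fun i : Fin (v + 1) => (i : ℕ) ∈ withRoot V).card
      ≤ (withRoot (V.filter (· < v))).card := by
    refine Finset.card_le_card_of_injOn (fun i => (i : ℕ)) ?_ (Fin.val_injective.injOn)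
    intro i hi
    have hi' : (i : ℕ) ∈ withRoot V := by simpa using hi
    have := i.isLt
    simp only [withRoot, Finset.mem_insert, Finset.mem_image] at hi'
    rcases hi' with h0 | ⟨a, ha, hai⟩
    · simp [withRoot, h0]
    · simp only [withRoot, Finset.coe_insert, Finset.coe_image, Finset.coe_filter]
      exact Or.inr ⟨a, ⟨ha, by omega⟩, hai⟩
  rw [card_withRoot] at h
  exact h

theorem subtreeWeight_insert {m : ℕ} {V : Finset ℕ} (hV : V ⊆ Finset.range m) :
    subtreeWeight (insert m V) =
      ((V.card + 1 : ℕ) : ℝ≥0∞) / ((m + 1 : ℕ) : ℝ≥0∞) * subtreeWeight V := by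
  have hm : m ∉ V := fun h => by simpa using hV h
  have hlt : ∀ v ∈ V, v < m := fun v hv => by simpa using hV hv
  rw [subtreeWeight, Finset.prod_insert hm, Finset.filter_insert, if_neg (lt_irrefl m),
    Finset.filter_true_of_mem hlt, subtreeWeight]
  congr 1
  refine Finset.prod_congr rfl fun v hv => ?_
  rw [Finset.filter_insert, if_neg (hlt v hv).not_gt]

theorem pow_add_mul_pow_le (a b : ℝ≥0∞) (k : ℕ) :
    a ^ (k + 1) + ((k + 1 : ℕ) : ℝ≥0∞) * b * a ^ k ≤ (a + b) ^ (k + 1) := by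
  induction k with
  | zero => simp
  | succ k ih =>
    calc a ^ (k + 1 + 1) + ((k + 1 + 1 : ℕ) : ℝ≥0∞) * b * a ^ (k + 1)
        = (a ^ (k + 1) + ((k + 1 : ℕ) : ℝ≥0∞) * b * a ^ k) * a + a ^ (k + 1) * b := by
          push_cast; ring
      _ ≤ (a + b) ^ (k + 1) * a + (a + b) ^ (k + 1) * b := by
          gcongr
          exact le_self_add
      _ = (a + b) ^ (k + 1 + 1) := by ring

/-- The expected number of rooted subtrees with `k + 1` vertices is at most the `k`-th power of the
expected degree of the root. -/
theorem sum_subtreeWeight_le (m k : ℕ) :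
    ∑ V ∈ Finset.powersetCard k (Finset.range m), subtreeWeight V ≤
      (∑ v ∈ Finset.range m, ((v + 1 : ℕ) : ℝ≥0∞)⁻¹) ^ k := by
  induction m generalizing k with
  | zero =>
    cases k with
    | zero => simp [subtreeWeight]
    | succ k => simp
  | succ m ih =>
    cases k with
    | zero => simp [subtreeWeight]
    | succ k =>
      rw [Finset.range_add_one, Finset.powersetCard_succ_insert (by simp),
        Finset.sum_union, Finset.sum_image, Finset.sum_insert (by simp)]
      · calc _ ≤ (∑ v ∈ Finset.range m, ((v + 1 : ℕ) : ℝ≥0∞)⁻¹) ^ (k + 1)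
              + ((k + 1 : ℕ) : ℝ≥0∞) * ((m + 1 : ℕ) : ℝ≥0∞)⁻¹
                * (∑ v ∈ Finset.range m, ((v + 1 : ℕ) : ℝ≥0∞)⁻¹) ^ k := by
              refine add_le_add (ih _) ?_
              refine le_trans (le_of_eq ?_) (mul_le_mul_right (ih k) _)
              rw [Finset.mul_sum]
              refine Finset.sum_congr rfl fun V hV => ?_
              rw [Finset.mem_powersetCard] at hV
              rw [subtreeWeight_insert hV.1, hV.2, div_eq_mul_inv]
          _ ≤ _ := pow_add_mul_pow_le _ _ _
          _ = _ := by rw [add_comm]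
      · intro V hV W hW h
        have hV' : m ∉ V := fun h' => by
          simpa using (Finset.mem_powersetCard.1 (Finset.mem_coe.1 hV)).1 h'
        have hW' : m ∉ W := fun h' => by
          simpa using (Finset.mem_powersetCard.1 (Finset.mem_coe.1 hW)).1 h'
        rw [← Finset.erase_insert hV', h, Finset.erase_insert hW']
      · rw [Finset.disjoint_left]
        intro V hV hV'
        obtain ⟨W, -, rfl⟩ := Finset.mem_image.1 hV'
        have := (Finset.mem_powersetCard.1 hV).1 (Finset.mem_insert_self m W)
        simp at this

/-! ### Absence of flux -/

/-- The exponential Markov inequality for the number of cars arriving in a set of vertices. -/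
theorem arrivals_ge_le (μ : PMF ℕ) (z : ℝ≥0∞) (hz : 1 ≤ z) (hz' : z ≠ ∞) (S : Finset ℕ) (r : ℕ) :
    (Measure.infinitePi fun _ : ℕ => μ.toMeasure) {x : ℕ → ℕ | r ≤ ∑ v ∈ S, x v} ≤
      (∑' k, μ k * z ^ k) ^ S.card * (z⁻¹) ^ r := by
  have hz0 : z ≠ 0 := (zero_lt_one.trans_le hz).ne'
  have hm : ∀ v : ℕ, Measurable fun x : ℕ → ℕ => z ^ x v := fun v =>
    (Measurable.of_discrete (f := fun k : ℕ => z ^ k)).comp (measurable_pi_apply v)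
  have hint : ∫⁻ x : ℕ → ℕ, ∏ v ∈ S, z ^ x v ∂(Measure.infinitePi fun _ : ℕ => μ.toMeasure)
      = (∑' k, μ k * z ^ k) ^ S.card := by
    rw [ProbabilityTheory.lintegral_prod_eq_prod_lintegral_of_indepFun S
      (fun v (x : ℕ → ℕ) => z ^ x v)
      (ProbabilityTheory.iIndepFun_infinitePi (X := fun _ k => z ^ k)
        fun _ => Measurable.of_discrete) hm]
    rw [Finset.prod_congr rfl, Finset.prod_const]
    intro v _
    rw [← (measurePreserving_eval_infinitePi (fun _ : ℕ => μ.toMeasure) v).lintegral_comp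
      (f := fun k : ℕ => z ^ k) Measurable.of_discrete |>.symm, lintegral_countable']
    refine tsum_congr fun k => ?_
    rw [PMF.toMeasure_apply_singleton _ _ (measurableSet_singleton k), mul_comm]
  have hsub : {x : ℕ → ℕ | r ≤ ∑ v ∈ S, x v} ⊆ {x : ℕ → ℕ | z ^ r ≤ ∏ v ∈ S, z ^ x v} := by
    intro x hx
    simp only [Set.mem_ofPred_eq, Finset.prod_pow_eq_pow_sum] at hx ⊢
    exact pow_le_pow_right₀ hz hx
  have hmark := mul_meas_ge_le_lintegral (μ := Measure.infinitePi fun _ : ℕ => μ.toMeasure)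
    (f := fun x : ℕ → ℕ => ∏ v ∈ S, z ^ x v) (Finset.measurable_prod S fun v _ => hm v) (z ^ r)
  rw [hint] at hmark
  refine (measure_mono hsub).trans ?_
  rw [← ENNReal.inv_pow, ← div_eq_mul_inv, ENNReal.le_div_iff_mul_le
    (Or.inl (pow_ne_zero _ hz0)) (Or.inl (ENNReal.pow_ne_top hz')), mul_comm]
  exact hmark

/-- A positive flux requires a rooted subtree with more cars than vertices. The union bound over
all rooted subtrees is a geometric series. -/
theorem parkingLaw_flux_pos_le (μ : PMF ℕ) (z : ℝ≥0∞) (hz : 1 ≤ z) (hz' : z ≠ ∞) (m : ℕ) :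
    parkingLaw μ {ω | 0 < flux ω.1 (m + 1) ω.2} ≤
      (∑' k, μ k * z ^ k) * z⁻¹ ^ 2 *
        (1 - (∑ v ∈ Finset.range m, ((v + 1 : ℕ) : ℝ≥0∞)⁻¹) * (∑' k, μ k * z ^ k) * z⁻¹)⁻¹ := by
  classical
  set A := ∑' k, μ k * z ^ k
  set H := ∑ v ∈ Finset.range m, ((v + 1 : ℕ) : ℝ≥0∞)⁻¹
  have hsub : {ω : Attachment × (ℕ → ℕ) | 0 < flux ω.1 (m + 1) ω.2} ⊆
      ⋃ V ∈ (Finset.range m).powerset, {t | ParentClosed t (withRoot V)} ×ˢ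
        {x : ℕ → ℕ | V.card + 2 ≤ ∑ v ∈ withRoot V, x v} := by
    rintro ⟨t, x⟩ h
    have h' : 0 < flux t (m + 1) x := h
    obtain ⟨S, hS, h0, hc, hle⟩ := exists_parentClosed_of_flux_pos h'
    have hSV : S = withRoot ((Finset.range m).filter fun v => v + 1 ∈ S) := by
      ext v
      simp only [withRoot, Finset.mem_insert, Finset.mem_image, Finset.mem_filter,
        Finset.mem_range]
      constructor
      · intro hv
        cases v with
        | zero => exact Or.inl rfl
        | succ v =>
          have := hS hv
          simp only [Finset.mem_range] at this
          exact Or.inr ⟨v, ⟨by omega, hv⟩, rfl⟩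
      · rintro (rfl | ⟨a, ⟨-, ha⟩, rfl⟩)
        exacts [h0, ha]
    simp only [Set.mem_iUnion]
    refine ⟨(Finset.range m).filter fun v => v + 1 ∈ S, by simp, ?_, ?_⟩
    · simpa only [Set.mem_ofPred_eq, ← hSV] using hc
    · have hcard := congrArg Finset.card hSV
      rw [card_withRoot] at hcard
      simp only [Set.mem_ofPred_eq]
      rw [← hSV]
      omega
  calc parkingLaw μ {ω | 0 < flux ω.1 (m + 1) ω.2}
      ≤ ∑ V ∈ (Finset.range m).powerset, parkingLaw μ ({t | ParentClosed t (withRoot V)} ×ˢ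
        {x : ℕ → ℕ | V.card + 2 ≤ ∑ v ∈ withRoot V, x v}) :=
        (measure_mono hsub).trans (measure_biUnion_finset_le _ _)
    _ ≤ ∑ V ∈ (Finset.range m).powerset,
          subtreeWeight V * (A ^ (V.card + 1) * z⁻¹ ^ (V.card + 2)) := by
        refine Finset.sum_le_sum fun V _ => ?_
        rw [parkingLaw, Measure.prod_prod]
        refine mul_le_mul' (treeLaw_parentClosed_le V) ?_
        rw [← card_withRoot]
        exact arrivals_ge_le μ z hz hz' _ _
    _ = ∑ k ∈ Finset.range (m + 1), ∑ V ∈ Finset.powersetCard k (Finset.range m),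
          subtreeWeight V * (A ^ (V.card + 1) * z⁻¹ ^ (V.card + 2)) := by
        rw [Finset.sum_powerset, Finset.card_range]
    _ ≤ ∑ k ∈ Finset.range (m + 1), A * z⁻¹ ^ 2 * (H * A * z⁻¹) ^ k := by
        refine Finset.sum_le_sum fun k _ => ?_
        calc _ = (∑ V ∈ Finset.powersetCard k (Finset.range m), subtreeWeight V)
              * (A ^ (k + 1) * z⁻¹ ^ (k + 2)) := by
              rw [Finset.sum_mul]
              refine Finset.sum_congr rfl fun V hV => ?_
              rw [(Finset.mem_powersetCard.1 hV).2]
          _ ≤ H ^ k * (A ^ (k + 1) * z⁻¹ ^ (k + 2)) := by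
              gcongr
              exact sum_subtreeWeight_le m k
          _ = _ := by ring
    _ ≤ _ := by
        rw [← Finset.mul_sum, ← ENNReal.tsum_geometric]
        gcongr
        exact ENNReal.sum_le_tsum _

/-! ### Exposing one vertex at a time -/

/-- All the sources of randomness as one family of random variables: the parents, indexed by
`Sum.inl`, and the numbers of arriving cars, indexed by `Sum.inr`. -/
def coord : ℕ ⊕ ℕ → Attachment × (ℕ → ℕ) → ℕ
  | Sum.inl v, ω => ω.1 v
  | Sum.inr v, ω => ω.2 v

theorem measurable_coord (i : ℕ ⊕ ℕ) : Measurable (coord i) := by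
  cases i with
  | inl v =>
    exact (Measurable.of_discrete (f := fun k : Fin (v + 1) => (k : ℕ))).comp
      ((measurable_pi_apply v).comp measurable_fst)
  | inr v => exact (measurable_pi_apply v).comp measurable_snd

theorem parkingLaw_rectangle (μ : PMF ℕ) (I J : Finset ℕ) (A B : ℕ → Set ℕ) :
    parkingLaw μ {ω | (∀ v ∈ I, (ω.1 v : ℕ) ∈ A v) ∧ ∀ v ∈ J, ω.2 v ∈ B v} =
      (∏ v ∈ I, (PMF.uniformOfFintype (Fin (v + 1))).toMeasure {i | (i : ℕ) ∈ A v}) *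
        ∏ v ∈ J, μ.toMeasure (B v) := by
  have h : {ω : Attachment × (ℕ → ℕ) | (∀ v ∈ I, (ω.1 v : ℕ) ∈ A v) ∧ ∀ v ∈ J, ω.2 v ∈ B v} =
      Set.pi (I : Set ℕ) (fun v => {i : Fin (v + 1) | (i : ℕ) ∈ A v}) ×ˢ
        Set.pi (J : Set ℕ) B := by
    ext ω
    simp [Set.mem_pi]
  rw [h, parkingLaw, Measure.prod_prod, treeLaw,
    Measure.infinitePi_pi _ (fun _ _ => MeasurableSet.of_discrete),
    Measure.infinitePi_pi _ (fun _ _ => MeasurableSet.of_discrete)]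

theorem iIndepFun_coord (μ : PMF ℕ) : ProbabilityTheory.iIndepFun coord (parkingLaw μ) := by
  classical
  rw [ProbabilityTheory.iIndepFun_iff_measure_inter_preimage_eq_mul]
  intro S A _
  have h : ⋂ i ∈ S, coord i ⁻¹' A i = {ω | (∀ v ∈ S.toLeft, (ω.1 v : ℕ) ∈ A (Sum.inl v)) ∧
      ∀ v ∈ S.toRight, ω.2 v ∈ A (Sum.inr v)} := by
    ext ω
    simp [coord]
  have hl : ∀ v, parkingLaw μ (coord (Sum.inl v) ⁻¹' A (Sum.inl v)) =
      (PMF.uniformOfFintype (Fin (v + 1))).toMeasure {i | (i : ℕ) ∈ A (Sum.inl v)} := by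
    intro v
    have := parkingLaw_rectangle μ {v} ∅ (fun v => A (Sum.inl v)) (fun v => A (Sum.inr v))
    simp only [Finset.prod_singleton, Finset.prod_empty, mul_one] at this
    rw [← this]
    congr 1
    ext ω
    simp [coord]
  have hr : ∀ v, parkingLaw μ (coord (Sum.inr v) ⁻¹' A (Sum.inr v)) =
      μ.toMeasure (A (Sum.inr v)) := by
    intro v
    have := parkingLaw_rectangle μ ∅ {v} (fun v => A (Sum.inl v)) (fun v => A (Sum.inr v))
    simp only [Finset.prod_singleton, Finset.prod_empty, one_mul] at this
    rw [← this]
    congr 1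
    ext ω
    simp [coord]
  rw [h, parkingLaw_rectangle μ _ _ (fun v => A (Sum.inl v)) (fun v => A (Sum.inr v))]
  conv_rhs => rw [← Finset.toLeft_disjSum_toRight (u := S), Finset.prod_disjSum]
  simp only [hl, hr]

/-- The function `G` depends only on the tree formed by the vertices `0, …, j` and on the numbers
of cars that arrive at these vertices. -/
def DependsOnPrefix {β : Type*} (j : ℕ) (G : Attachment × (ℕ → ℕ) → β) : Prop :=
  ∀ ω ω' : Attachment × (ℕ → ℕ), (∀ v < j, ω.1 v = ω'.1 v) → (∀ v ≤ j, ω.2 v = ω'.2 v) →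
    G ω = G ω'

theorem DependsOnPrefix.mono {β : Type*} {i j : ℕ} (hij : i ≤ j)
    {G : Attachment × (ℕ → ℕ) → β} (hG : DependsOnPrefix i G) : DependsOnPrefix j G :=
  fun ω ω' h h' => hG ω ω' (fun v hv => h v (by omega)) (fun v hv => h' v (by omega))

/-- The coordinates that determine the restriction to the vertices `0, …, j`. -/
def prefixCoords (j : ℕ) : Finset (ℕ ⊕ ℕ) := (Finset.range j).disjSum (Finset.range (j + 1))

theorem DependsOnPrefix.exists_comp {β : Type*} [Nonempty β] {j : ℕ}
    {G : Attachment × (ℕ → ℕ) → β} (hG : DependsOnPrefix j G) :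
    ∃ g : (prefixCoords j → ℕ) → β, G = g ∘ fun ω (i : prefixCoords j) => coord i ω := by
  rw [← Function.factorsThrough_iff]
  intro ω ω' h
  refine hG ω ω' (fun v hv => ?_) (fun v hv => ?_)
  · exact Fin.ext (congrFun h ⟨Sum.inl v, by simpa [prefixCoords] using hv⟩)
  · exact congrFun h ⟨Sum.inr v, by simpa [prefixCoords] using Nat.lt_succ_of_le hv⟩

theorem measurable_prefixCoords (j : ℕ) :
    Measurable fun (ω : Attachment × (ℕ → ℕ)) (i : prefixCoords j) => coord i ω :=
  measurable_pi_lambda _ fun i => measurable_coord i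

theorem DependsOnPrefix.measurable {j : ℕ} {G : Attachment × (ℕ → ℕ) → ℝ≥0∞}
    (hG : DependsOnPrefix j G) : Measurable G := by
  obtain ⟨g, rfl⟩ := hG.exists_comp
  exact Measurable.of_discrete.comp (measurable_prefixCoords j)

/-- The vertex `j + 1` is attached to a given earlier vertex and receives at least `c` cars. -/
def attachEvent (j v c : ℕ) : Set (Attachment × (ℕ → ℕ)) :=
  {ω | (ω.1 j : ℕ) = v ∧ c ≤ ω.2 (j + 1)}

theorem attachEvent_eq (j v c : ℕ) : attachEvent j v c =
    coord (Sum.inl j) ⁻¹' {v} ∩ coord (Sum.inr (j + 1)) ⁻¹' Set.Ici c := rfl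

theorem measurableSet_attachEvent (j v c : ℕ) : MeasurableSet (attachEvent j v c) := by
  rw [attachEvent_eq]
  exact (measurable_coord _ MeasurableSet.of_discrete).inter
    (measurable_coord _ MeasurableSet.of_discrete)

theorem parkingLaw_attachEvent (μ : PMF ℕ) {j v : ℕ} (hv : v ≤ j) (c : ℕ) :
    parkingLaw μ (attachEvent j v c) = ((j + 1 : ℕ) : ℝ≥0∞)⁻¹ * μ.toMeasure (Set.Ici c) := by
  have h := parkingLaw_rectangle μ {j} {j + 1} (fun _ => {v}) (fun _ => Set.Ici c)
  simp only [Finset.prod_singleton, Finset.mem_singleton, forall_eq] at h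
  have h2 : {i : Fin (j + 1) | (i : ℕ) ∈ ({v} : Set ℕ)} = {⟨v, by omega⟩} := by
    ext i
    simp [Fin.ext_iff]
  rw [h2, PMF.toMeasure_apply_singleton _ _ (measurableSet_singleton _),
    PMF.uniformOfFintype_apply, Fintype.card_fin] at h
  exact h

theorem lintegral_mul_attachEvent (μ : PMF ℕ) {j v : ℕ} (hv : v ≤ j) (c : ℕ)
    {G : Attachment × (ℕ → ℕ) → ℝ≥0∞} (hG : DependsOnPrefix j G) :
    ∫⁻ ω, G ω * (attachEvent j v c).indicator 1 ω ∂(parkingLaw μ) =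
      (∫⁻ ω, G ω ∂(parkingLaw μ)) * (((j + 1 : ℕ) : ℝ≥0∞)⁻¹ * μ.toMeasure (Set.Ici c)) := by
  classical
  have hmeas := hG.measurable
  obtain ⟨g, hg⟩ := hG.exists_comp
  set T : Finset (ℕ ⊕ ℕ) := {Sum.inl j, Sum.inr (j + 1)} with hT
  have hdisj : Disjoint (prefixCoords j) T := by
    simp [hT, prefixCoords]
  have hind := (iIndepFun_coord μ).indepFun_finset _ T hdisj measurable_coord
  set f : (T → ℕ) → ℝ≥0∞ := fun w =>
    if w ⟨Sum.inl j, by simp [hT]⟩ = v ∧ c ≤ w ⟨Sum.inr (j + 1), by simp [hT]⟩ then 1 else 0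
  have hf : (attachEvent j v c).indicator (1 : Attachment × (ℕ → ℕ) → ℝ≥0∞) =
      f ∘ fun ω (i : T) => coord i ω := by
    ext ω
    simp only [Set.indicator, attachEvent, f, Function.comp, coord, Pi.one_apply,
      Set.mem_ofPred_eq]
    congr
  have hind' := hind.comp (φ := g) (ψ := f) Measurable.of_discrete Measurable.of_discrete
  rw [← hg, ← hf] at hind'
  rw [ProbabilityTheory.lintegral_mul_eq_lintegral_mul_lintegral_of_indepFun''
    hmeas.aemeasurable
    (measurable_one.indicator (measurableSet_attachEvent j v c)).aemeasurable hind',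
    lintegral_indicator_one (measurableSet_attachEvent j v c), parkingLaw_attachEvent μ hv]

/-- The effect of the vertex `j + 1` on a Laplace transform: given the tree on the vertices
`0, …, j`, this vertex is attached to the set `D` and receives at least `c` cars with probability
`q * #D / (j + 1)`. -/
theorem lintegral_expose_le (μ : PMF ℕ) (j c : ℕ) {G : Attachment × (ℕ → ℕ) → ℝ≥0∞}
    (hG : DependsOnPrefix j G) (hG1 : ∀ ω, G ω ≤ 1) {D : Attachment × (ℕ → ℕ) → Finset ℕ}
    (hD : DependsOnPrefix j D) (hDj : ∀ ω, D ω ⊆ Finset.range (j + 1)) {p : ℝ}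
    (hp0 : 0 ≤ p) (hp1 : p ≤ 1) :
    ∫⁻ ω, G ω * (if (ω.1 j : ℕ) ∈ D ω ∧ c ≤ ω.2 (j + 1) then ENNReal.ofReal p else 1)
        ∂(parkingLaw μ) ≤
      ∫⁻ ω, G ω * ENNReal.ofReal (Real.exp (-((1 - p) * (μ.toMeasure (Set.Ici c)).toReal *
        ((j : ℝ) + 1)⁻¹))) ^ (D ω).card ∂(parkingLaw μ) := by
  classical
  set P := parkingLaw μ
  set q := (μ.toMeasure (Set.Ici c)).toReal with hq
  have hq0 : 0 ≤ q := ENNReal.toReal_nonneg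
  set κ : ℝ := (1 - p) * q * ((j : ℝ) + 1)⁻¹ with hκ
  have hκ0 : 0 ≤ κ := by
    have : 0 ≤ 1 - p := by linarith
    positivity
  set F : Attachment × (ℕ → ℕ) → ℝ≥0∞ :=
    fun ω => if (ω.1 j : ℕ) ∈ D ω ∧ c ≤ ω.2 (j + 1) then ENNReal.ofReal p else 1 with hF
  set X : Attachment × (ℕ → ℕ) → ℝ≥0∞ := fun ω => ENNReal.ofReal (1 - p) *
    ∑ v ∈ Finset.range (j + 1), (if v ∈ D ω then G ω else 0) * (attachEvent j v c).indicator 1 ω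
    with hX
  have hGv : ∀ v, DependsOnPrefix j fun ω => if v ∈ D ω then G ω else 0 := by
    intro v ω ω' h h'
    simp only [hD ω ω' h h', hG ω ω' h h']
  have hXmeas' : ∀ v, Measurable fun ω =>
      (if v ∈ D ω then G ω else 0) * (attachEvent j v c).indicator 1 ω := fun v =>
    (hGv v).measurable.mul (measurable_one.indicator (measurableSet_attachEvent j v c))
  have hXmeas : Measurable X :=
    (Finset.measurable_sum _ fun v _ => hXmeas' v).const_mul _
  -- `X` is the loss `(1 - p) * G` on the event that the vertex `j + 1` is selected
  have hsplit : ∀ ω, G ω * F ω + X ω = G ω := by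
    intro ω
    have h1 : ∑ v ∈ Finset.range (j + 1), (if v ∈ D ω then G ω else 0) *
        (attachEvent j v c).indicator 1 ω =
        if (ω.1 j : ℕ) ∈ D ω ∧ c ≤ ω.2 (j + 1) then G ω else 0 := by
      rw [Finset.sum_eq_single (ω.1 j : ℕ)]
      · by_cases h1 : (ω.1 j : ℕ) ∈ D ω <;> by_cases h2 : c ≤ ω.2 (j + 1) <;>
          simp [attachEvent, h1, h2]
      · intro v _ hv
        simp [attachEvent, hv.symm]
      · intro h
        exact absurd (Finset.mem_range.2 (ω.1 j).isLt) h
    simp only [hX, hF, h1]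
    split_ifs
    · rw [mul_comm (ENNReal.ofReal (1 - p)), ← mul_add, ← ENNReal.ofReal_add hp0 (by linarith)]
      simp
    · simp
  have hXint : ∫⁻ ω, X ω ∂P = ∫⁻ ω, G ω * ENNReal.ofReal (κ * (D ω).card) ∂P := by
    have hκ' : ENNReal.ofReal κ =
        ENNReal.ofReal (1 - p) * (((j + 1 : ℕ) : ℝ≥0∞)⁻¹ * μ.toMeasure (Set.Ici c)) := by
      rw [hκ, mul_assoc, ENNReal.ofReal_mul (by linarith), mul_comm q,
        ENNReal.ofReal_mul (by positivity), hq, ENNReal.ofReal_toReal (measure_ne_top _ _),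
        ENNReal.ofReal_inv_of_pos (by positivity)]
      congr 3
      rw [← ENNReal.ofReal_natCast]
      push_cast
      rfl
    rw [hX, lintegral_const_mul _ (Finset.measurable_sum _ fun v _ => hXmeas' v),
      lintegral_finsetSum _ fun v _ => hXmeas' v]
    calc _ = ENNReal.ofReal (1 - p) * ∑ v ∈ Finset.range (j + 1),
          (∫⁻ ω, (if v ∈ D ω then G ω else 0) ∂P) *
            (((j + 1 : ℕ) : ℝ≥0∞)⁻¹ * μ.toMeasure (Set.Ici c)) := by
          congr 1
          refine Finset.sum_congr rfl fun v hv => ?_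
          exact lintegral_mul_attachEvent μ (Nat.lt_succ_iff.1 (Finset.mem_range.1 hv)) c (hGv v)
      _ = (∫⁻ ω, ∑ v ∈ Finset.range (j + 1), (if v ∈ D ω then G ω else 0) ∂P) *
            ENNReal.ofReal κ := by
          rw [lintegral_finsetSum _ fun v _ => (hGv v).measurable, hκ', ← Finset.sum_mul]
          ring
      _ = ∫⁻ ω, (∑ v ∈ Finset.range (j + 1), (if v ∈ D ω then G ω else 0)) *
            ENNReal.ofReal κ ∂P := by
          rw [lintegral_mul_const _ (Finset.measurable_sum _ fun v _ => (hGv v).measurable)]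
      _ = _ := by
          refine lintegral_congr fun ω => ?_
          rw [← Finset.sum_filter, Finset.sum_const, Finset.filter_mem_eq_inter,
            Finset.inter_eq_right.2 (hDj ω), nsmul_eq_mul, ENNReal.ofReal_mul hκ0,
            ENNReal.ofReal_natCast]
          ring
  have hXfin : ∫⁻ ω, X ω ∂P ≠ ∞ := by
    refine ne_top_of_le_ne_top (b := 1) ENNReal.one_ne_top ?_
    calc ∫⁻ ω, X ω ∂P ≤ ∫⁻ _, 1 ∂P := by
          refine lintegral_mono fun ω => ?_
          exact (le_add_self.trans (hsplit ω).le).trans (hG1 ω)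
      _ = 1 := by simp
  have hcard : DependsOnPrefix j fun ω => G ω * ENNReal.ofReal (Real.exp (-κ)) ^ (D ω).card := by
    intro ω ω' h h'
    simp only [hD ω ω' h h', hG ω ω' h h']
  have hmain : ∫⁻ ω, G ω * F ω ∂P + ∫⁻ ω, X ω ∂P ≤
      ∫⁻ ω, G ω * ENNReal.ofReal (Real.exp (-κ)) ^ (D ω).card ∂P + ∫⁻ ω, X ω ∂P := by
    rw [← lintegral_add_right _ hXmeas, lintegral_congr hsplit, hXint,
      ← lintegral_add_left hcard.measurable]
    refine lintegral_mono fun ω => ?_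
    rw [← mul_add, ← ENNReal.ofReal_pow (Real.exp_pos _).le,
      ← ENNReal.ofReal_add (by positivity) (by positivity), ← Real.exp_nat_mul]
    refine le_mul_of_one_le_right' ?_
    rw [ENNReal.one_le_ofReal]
    have := Real.add_one_le_exp (((D ω).card : ℝ) * -κ)
    linarith
  exact (ENNReal.add_le_add_iff_right hXfin).1 hmain

/-! ### Descending chains with prescribed numbers of cars -/

/-- The indices `j`, `a ≤ j < b`, such that the vertex `j + 1` is attached to `D` and receives at
least `c` cars. -/
def attached (D : Finset ℕ) (a b c : ℕ) (ω : Attachment × (ℕ → ℕ)) : Finset ℕ :=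
  (Finset.Ico a b).filter fun j => (ω.1 j : ℕ) ∈ D ∧ c ≤ ω.2 (j + 1)

/-- `level e c i ω` is the set of end points of the chains of `i` edges that descend from the root,
whose `l`-th edge leads to a vertex `j + 1` with `e (l - 1) ≤ j < e l` at which at least
`c (l - 1)` cars arrive. -/
def level (e c : ℕ → ℕ) : ℕ → Attachment × (ℕ → ℕ) → Finset ℕ
  | 0, _ => {0}
  | i + 1, ω => (attached (level e c i ω) (e i) (e (i + 1)) (c i) ω).image (· + 1)

theorem level_subset (e c : ℕ → ℕ) (i : ℕ)
    (ω : Attachment × (ℕ → ℕ)) : level e c i ω ⊆ Finset.range (e i + 1) := by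
  cases i with
  | zero => simp [level]
  | succ i =>
    intro v hv
    simp only [level, attached, Finset.mem_image, Finset.mem_filter, Finset.mem_Ico] at hv
    obtain ⟨j, ⟨⟨-, hj⟩, -⟩, rfl⟩ := hv
    simpa using hj

theorem dependsOnPrefix_attached {D : Attachment × (ℕ → ℕ) → Finset ℕ} {a : ℕ}
    (hD : DependsOnPrefix a D) {b : ℕ} (hab : a ≤ b) (c : ℕ) :
    DependsOnPrefix b fun ω => attached (D ω) a b c ω := by
  intro ω ω' h h'
  have hD' := hD.mono hab ω ω' h h'
  refine Finset.filter_congr fun j hj => ?_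
  have hj' := (Finset.mem_Ico.1 hj).2
  simp only [hD', h j hj', h' (j + 1) hj']

theorem dependsOnPrefix_level {e : ℕ → ℕ} (he : Monotone e) (c : ℕ → ℕ) (i : ℕ) :
    DependsOnPrefix (e i) (level e c i) := by
  induction i with
  | zero => exact fun _ _ _ _ => rfl
  | succ i ih =>
    intro ω ω' h h'
    have := dependsOnPrefix_attached ih (he (Nat.le_succ i)) (c i) ω ω' h h'
    simp only [level]
    dsimp only at this
    rw [this]

theorem attached_succ_card (D : Finset ℕ) {a b : ℕ} (hab : a ≤ b) (c : ℕ)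
    (ω : Attachment × (ℕ → ℕ)) : (attached D a (b + 1) c ω).card =
      (attached D a b c ω).card + if (ω.1 b : ℕ) ∈ D ∧ c ≤ ω.2 (b + 1) then 1 else 0 := by
  rw [attached, ← Finset.insert_Ico_right_eq_Ico_add_one hab, Finset.filter_insert]
  split_ifs with h
  · rw [Finset.card_insert_of_notMem (by simp), attached]
  · rw [attached, add_zero]

theorem lintegral_attached_le (μ : PMF ℕ) {e : ℕ → ℕ} (he : Monotone e) (c : ℕ → ℕ) (i : ℕ)
    {p : ℝ} (hp0 : 0 ≤ p) (hp1 : p ≤ 1) (b : ℕ) (hb : e i ≤ b) (r : ℝ) (hr0 : 0 ≤ r)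
    (hr1 : r ≤ 1) :
    ∫⁻ ω, ENNReal.ofReal r ^ (level e c i ω).card *
        ENNReal.ofReal p ^ (attached (level e c i ω) (e i) b (c i) ω).card ∂(parkingLaw μ) ≤
      ∫⁻ ω, ENNReal.ofReal (r * Real.exp (-((1 - p) * (μ.toMeasure (Set.Ici (c i))).toReal *
        ∑ j ∈ Finset.Ico (e i) b, ((j : ℝ) + 1)⁻¹))) ^ (level e c i ω).card ∂(parkingLaw μ) := by
  induction b, hb using Nat.le_induction generalizing r with
  | base => simp [attached]
  | succ b hb ih =>
    set q := (μ.toMeasure (Set.Ici (c i))).toReal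
    have hq0 : 0 ≤ q := ENNReal.toReal_nonneg
    set ρ := Real.exp (-((1 - p) * q * ((b : ℝ) + 1)⁻¹)) with hρ
    have hρ1 : ρ ≤ 1 := by
      have : 0 ≤ 1 - p := by linarith
      have : 0 ≤ (1 - p) * q * ((b : ℝ) + 1)⁻¹ := by positivity
      exact Real.exp_le_one_iff.2 (by linarith)
    have hL : DependsOnPrefix b (level e c i) := (dependsOnPrefix_level he c i).mono hb
    have hA := dependsOnPrefix_attached (dependsOnPrefix_level he c i) hb (c i)
    calc _ = ∫⁻ ω, (ENNReal.ofReal r ^ (level e c i ω).card *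
          ENNReal.ofReal p ^ (attached (level e c i ω) (e i) b (c i) ω).card) *
          (if (ω.1 b : ℕ) ∈ level e c i ω ∧ c i ≤ ω.2 (b + 1) then ENNReal.ofReal p else 1)
          ∂(parkingLaw μ) := by
          refine lintegral_congr fun ω => ?_
          rw [attached_succ_card _ hb, pow_add, mul_assoc]
          congr 2
          split_ifs <;> simp
      _ ≤ ∫⁻ ω, (ENNReal.ofReal r ^ (level e c i ω).card *
          ENNReal.ofReal p ^ (attached (level e c i ω) (e i) b (c i) ω).card) *
          ENNReal.ofReal ρ ^ (level e c i ω).card ∂(parkingLaw μ) := by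
          refine lintegral_expose_le μ b (c i) ?_ (fun ω => ?_) hL (fun ω => ?_) hp0 hp1
          · intro ω ω' h h'
            have := hA ω ω' h h'
            dsimp only at this ⊢
            rw [this, hL ω ω' h h']
          · exact mul_le_one' (pow_le_one' (ENNReal.ofReal_le_one.2 hr1) _)
              (pow_le_one' (ENNReal.ofReal_le_one.2 hp1) _)
          · exact (level_subset e c i ω).trans (Finset.range_mono (by omega))
      _ = ∫⁻ ω, ENNReal.ofReal (r * ρ) ^ (level e c i ω).card *
          ENNReal.ofReal p ^ (attached (level e c i ω) (e i) b (c i) ω).card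
          ∂(parkingLaw μ) := by
          refine lintegral_congr fun ω => ?_
          rw [ENNReal.ofReal_mul hr0, mul_pow]
          ring
      _ ≤ _ := ih (r * ρ) (by positivity) (mul_le_one₀ hr1 (Real.exp_pos _).le hρ1)
      _ = _ := by
          rw [Finset.sum_Ico_succ_top hb, hρ, mul_assoc r, ← Real.exp_add]
          congr! 6
          ring

/-- The conditional mean number of children, in the next level, of a vertex of level `i`. -/
noncomputable def growth (μ : PMF ℕ) (e c : ℕ → ℕ) (i : ℕ) : ℝ :=
  (μ.toMeasure (Set.Ici (c i))).toReal * ∑ j ∈ Finset.Ico (e i) (e (i + 1)), ((j : ℝ) + 1)⁻¹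

/-- The expected number of vertices of level `i`. -/
noncomputable def levelMean (μ : PMF ℕ) (e c : ℕ → ℕ) (i : ℕ) : ℝ :=
  ∏ l ∈ Finset.range i, growth μ e c l

theorem lintegral_level_succ_le (μ : PMF ℕ) {e : ℕ → ℕ} (he : Monotone e) (c : ℕ → ℕ) (i : ℕ)
    {p : ℝ} (hp0 : 0 ≤ p) (hp1 : p ≤ 1) :
    ∫⁻ ω, ENNReal.ofReal p ^ (level e c (i + 1) ω).card ∂(parkingLaw μ) ≤
      ∫⁻ ω, ENNReal.ofReal (Real.exp (-((1 - p) * growth μ e c i))) ^ (level e c i ω).card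
        ∂(parkingLaw μ) := by
  have h := lintegral_attached_le μ he c i hp0 hp1 (e (i + 1)) (he (Nat.le_succ i)) 1
    zero_le_one le_rfl
  simp only [ENNReal.ofReal_one, one_pow, one_mul] at h
  simp only [level, Finset.card_image_of_injective _ (add_left_injective 1), growth]
  simpa only [mul_assoc] using h

/-- A bound for the Laplace transform of the size of a level, in the parametrization `y / (1 + y)`
in which `exp (-(1 - p) * a) ≤ 1 / (1 + (1 - p) * a)` becomes the affine map
`y ↦ (1 + y) / a`. -/
theorem lintegral_level_le (μ : PMF ℕ) {e : ℕ → ℕ} (he : Monotone e) (c : ℕ → ℕ) (i : ℕ)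
    (hpos : ∀ l < i, 0 < growth μ e c l) {y : ℝ} (hy : 0 ≤ y) :
    ∫⁻ ω, ENNReal.ofReal (y / (1 + y)) ^ (level e c i ω).card ∂(parkingLaw μ) ≤
      ENNReal.ofReal (∑ l ∈ Finset.range i, (levelMean μ e c (l + 1))⁻¹ +
        y * (levelMean μ e c i)⁻¹) := by
  induction i generalizing y with
  | zero =>
    simp only [level, Finset.card_singleton, pow_one, lintegral_const, measure_univ, mul_one,
      levelMean, Finset.range_zero, Finset.sum_empty, Finset.prod_empty, inv_one, zero_add]
    exact ENNReal.ofReal_le_ofReal (div_le_self hy (by linarith))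
  | succ i ih =>
    have ha : 0 < growth μ e c i := hpos i (Nat.lt_succ_self i)
    set a := growth μ e c i with hadef
    have hy1 : 0 < 1 + y := by linarith
    have hle1 : y / (1 + y) ≤ 1 := (div_le_one hy1).2 (by linarith)
    refine (lintegral_level_succ_le μ he c i (by positivity) hle1).trans ?_
    have hexp : Real.exp (-((1 - y / (1 + y)) * a)) ≤ ((1 + y) / a) / (1 + (1 + y) / a) := by
      have h1 : (1 - y / (1 + y)) * a = a / (1 + y) := by field_simp; ring
      have h2 : ((1 + y) / a) / (1 + (1 + y) / a) = (1 + a / (1 + y))⁻¹ := by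
        field_simp
        ring
      rw [h1, h2, Real.exp_neg]
      have := Real.add_one_le_exp (a / (1 + y))
      gcongr
      linarith
    refine (lintegral_mono fun ω => ?_).trans
      ((ih (fun l hl => hpos l (by omega)) (y := (1 + y) / a) (by positivity)).trans
        (le_of_eq ?_))
    · gcongr
    · congr 1
      have h3 : levelMean μ e c (i + 1) = levelMean μ e c i * a := by
        rw [levelMean, Finset.prod_range_succ, levelMean]
      rw [Finset.sum_range_succ, h3, mul_inv]
      ring

/-- It is unlikely that a level is empty if the expected sizes of all levels up to it are large. -/
theorem parkingLaw_level_empty_le (μ : PMF ℕ) {e : ℕ → ℕ} (he : Monotone e) (c : ℕ → ℕ) (i : ℕ)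
    (hpos : ∀ l < i, 0 < growth μ e c l) :
    parkingLaw μ {ω | level e c i ω = ∅} ≤
      ENNReal.ofReal (∑ l ∈ Finset.range i, (levelMean μ e c (l + 1))⁻¹) := by
  have h := lintegral_level_le μ he c i hpos (y := 0) le_rfl
  simp only [zero_div, zero_mul, add_zero, ENNReal.ofReal_zero] at h
  have hmeas : MeasurableSet {ω | level e c i ω = ∅} := by
    have hd : DependsOnPrefix (e i) fun ω =>
        if level e c i ω = ∅ then (1 : ℝ≥0∞) else 0 := fun ω ω' h h' => by
      simp only [dependsOnPrefix_level he c i ω ω' h h']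
    convert hd.measurable (measurableSet_singleton 1) using 1
    ext ω
    simp
  refine le_trans ?_ h
  rw [← lintegral_indicator_one hmeas]
  refine lintegral_mono fun ω => ?_
  by_cases hω : level e c i ω = ∅ <;> simp [hω]

/-- A chain ending in a given level is, together with the root, a rooted subtree. -/
theorem exists_chain {e : ℕ → ℕ} (he : Monotone e) (c : ℕ → ℕ) (ω : Attachment × (ℕ → ℕ))
    (i : ℕ) (u : ℕ) (hu : u ∈ level e c i ω) :
    ∃ S ⊆ Finset.Ico (e 0 + 1) (e i + 1), u ∈ insert 0 S ∧ ParentClosed ω.1 (insert 0 S) ∧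
      S.card = i ∧ ∑ l ∈ Finset.range i, c l ≤ ∑ v ∈ S, ω.2 v := by
  induction i generalizing u with
  | zero =>
    refine ⟨∅, by simp, by simpa [level] using hu, ?_, by simp, by simp⟩
    intro v hv
    simp at hv
  | succ i ih =>
    simp only [level, attached, Finset.mem_image, Finset.mem_filter, Finset.mem_Ico] at hu
    obtain ⟨j, ⟨⟨hj1, hj2⟩, hjD, hjc⟩, rfl⟩ := hu
    obtain ⟨S, hS, hmem, hcl, hcard, hsum⟩ := ih _ hjD
    have hjS : j + 1 ∉ S := fun h => by
      have := (Finset.mem_Ico.1 (hS h)).2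
      omega
    refine ⟨insert (j + 1) S, ?_, by simp, ?_, ?_, ?_⟩
    · intro v hv
      rcases Finset.mem_insert.1 hv with rfl | hv
      · have := he (Nat.zero_le i)
        simp only [Finset.mem_Ico]
        omega
      · have := Finset.mem_Ico.1 (hS hv)
        have := he (Nat.le_succ i)
        simp only [Finset.mem_Ico, Nat.succ_eq_add_one] at *
        omega
    · intro v hv
      rw [Finset.insert_comm] at hv ⊢
      rcases Finset.mem_insert.1 hv with hv | hv
      · obtain rfl : v = j := by omega
        exact Finset.mem_insert_of_mem hmem
      · exact Finset.mem_insert_of_mem (hcl v hv)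
    · rw [Finset.card_insert_of_notMem hjS, hcard]
    · rw [Finset.sum_range_succ, Finset.sum_insert hjS]
      omega

/-- If the cars along a chain of `H` edges outnumber its non-root vertices, then `R` chains in
disjoint ranges of vertices produce a flux of `R - 1`: one car is lost at the root. -/
theorem le_flux_of_level_nonempty {E : ℕ → ℕ} (hE : Monotone E) (c : ℕ → ℕ) (H : ℕ)
    (hc : H + 1 ≤ ∑ l ∈ Finset.range H, c l) (ω : Attachment × (ℕ → ℕ)) (R n : ℕ)
    (hn : E (R * H) + 1 ≤ n)
    (h : ∀ r < R, level (fun i => E (r * H + i)) c H ω ≠ ∅) : R ≤ flux ω.1 n ω.2 + 1 := by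
  have key : ∀ Q ≤ R, ∃ S ⊆ Finset.Ico 1 (E (Q * H) + 1), ParentClosed ω.1 (insert 0 S) ∧
      S.card = Q * H ∧ Q * (H + 1) ≤ ∑ v ∈ S, ω.2 v := by
    intro Q hQ
    induction Q with
    | zero =>
      refine ⟨∅, by simp, ?_, by simp, by simp⟩
      intro v hv
      simp at hv
    | succ Q ih =>
      obtain ⟨S, hS, hcl, hcard, hsum⟩ := ih (by omega)
      obtain ⟨u, hu⟩ := Finset.nonempty_iff_ne_empty.2 (h Q (by omega))
      obtain ⟨T, hT, -, hTcl, hTcard, hTsum⟩ := exists_chain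
        (e := fun i => E (Q * H + i)) (fun a b hab => hE (by omega)) c ω H u hu
      have hEle := hE (show Q * H ≤ (Q + 1) * H by nlinarith)
      have hQ1 : (Q + 1) * H = Q * H + H := by ring
      have hdisj : Disjoint S T := by
        rw [Finset.disjoint_left]
        intro v hv hv'
        have h1 := Finset.mem_Ico.1 (hS hv)
        have h2 := Finset.mem_Ico.1 (hT hv')
        simp only [add_zero] at h2
        omega
      refine ⟨S ∪ T, ?_, ?_, ?_, ?_⟩
      · intro v hv
        rcases Finset.mem_union.1 hv with hv | hv
        · have h1 := Finset.mem_Ico.1 (hS hv)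
          simp only [Finset.mem_Ico]
          omega
        · have h2 := Finset.mem_Ico.1 (hT hv)
          simp only [Finset.mem_Ico, hQ1]
          omega
      · intro v hv
        rcases Finset.mem_insert.1 hv with hv | hv
        · omega
        · rcases Finset.mem_union.1 hv with hv | hv
          · have := hcl v (Finset.mem_insert_of_mem hv)
            simp only [Finset.mem_insert, Finset.mem_union] at this ⊢
            tauto
          · have := hTcl v (Finset.mem_insert_of_mem hv)
            simp only [Finset.mem_insert, Finset.mem_union] at this ⊢
            tauto
      · rw [Finset.card_union_of_disjoint hdisj, hcard, hTcard, hQ1]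
      · rw [Finset.sum_union hdisj]
        have : (Q + 1) * (H + 1) = Q * (H + 1) + (H + 1) := by ring
        omega
  obtain ⟨S, hS, hcl, hcard, hsum⟩ := key R le_rfl
  have h0 : 0 ∉ S := fun h => by simpa using hS h
  have hsub : insert 0 S ⊆ Finset.range n := by
    intro v hv
    rcases Finset.mem_insert.1 hv with rfl | hv
    · simp only [Finset.mem_range]
      omega
    · have := Finset.mem_Ico.1 (hS hv)
      simp only [Finset.mem_range]
      omega
  have hle := hcl.sum_le hsub ω.2
  rw [Finset.sum_insert h0, Finset.card_insert_of_notMem h0, hcard] at hle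
  have : R * (H + 1) = R * H + R := by ring
  omega

/-! ### Chains in geometric ranges of labels -/

theorem log_le_sum_Ico_inv {a b : ℕ} (hab : a ≤ b) :
    Real.log ((b + 1 : ℝ) / (a + 1)) ≤ ∑ j ∈ Finset.Ico a b, ((j : ℝ) + 1)⁻¹ := by
  induction b, hab using Nat.le_induction with
  | base => simp [div_self (by positivity : (a + 1 : ℝ) ≠ 0)]
  | succ b hab ih =>
    rw [Finset.sum_Ico_succ_top hab]
    have h1 : ((b + 1 : ℕ) + 1 : ℝ) / (a + 1) = (b + 1 : ℝ) / (a + 1) * ((b + 2 : ℝ) / (b + 1)) := by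
      push_cast
      field_simp
      ring
    rw [h1, Real.log_mul (by positivity) (by positivity)]
    have h2 := Real.log_le_sub_one_of_pos (show (0 : ℝ) < (b + 2 : ℝ) / (b + 1) by positivity)
    have h3 : (b + 2 : ℝ) / (b + 1) - 1 = ((b : ℝ) + 1)⁻¹ := by field_simp; ring
    linarith

theorem le_log_floor_exp {y : ℝ} (hy : 2 ≤ y) : y / 2 ≤ Real.log ⌊Real.exp y⌋₊ := by
  have hexp := Real.add_one_le_exp y
  have h := Nat.lt_floor_add_one (Real.exp y)
  have h2 := Real.log_le_log (by positivity) (show Real.exp y / 2 ≤ ⌊Real.exp y⌋₊ by linarith)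
  rw [Real.log_div (by positivity) (by norm_num), Real.log_exp] at h2
  have := Real.log_two_lt_d9
  linarith

/-- The numbers of cars prescribed along a chain: `g` groups of `k` vertices, the last vertex of
each group receiving `k` cars, followed by one vertex with `k'` cars. -/
def chainCars (k k' g : ℕ) (l : ℕ) : ℕ :=
  if l = g * k then k' else if k ∣ l + 1 then k else 0

theorem sum_chainCars {k : ℕ} (hk : 1 ≤ k) (k' g : ℕ) :
    ∑ l ∈ Finset.range (g * k + 1), chainCars k k' g l = g * k + k' := by
  have h : ∀ i ≤ g * k, ∑ l ∈ Finset.range i, chainCars k k' g l = i / k * k := by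
    intro i hi
    induction i with
    | zero => simp
    | succ i ih =>
      rw [Finset.sum_range_succ, ih (by omega), chainCars, if_neg (by omega), Nat.succ_div]
      split_ifs <;> ring
  rw [Finset.sum_range_succ, h _ le_rfl, Nat.mul_div_cancel _ hk, chainCars, if_pos rfl]

/-- A vertex below `b ^ l` has on average at least `log b` children among the vertices
`b ^ l, …, b ^ (l + 1) - 1`, which are the vertices `j + 1` for the indices `j` of the sum. -/
theorem log_le_sum_Ico_pow {b : ℕ} (hb : 1 ≤ b) (l : ℕ) :
    Real.log b ≤ ∑ j ∈ Finset.Ico (b ^ l - 1) (b ^ (l + 1) - 1), ((j : ℝ) + 1)⁻¹ := by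
  have h1 : ∀ l, 1 ≤ b ^ l := fun l => Nat.one_le_pow _ _ hb
  have h2 : ∀ l, ((b ^ l - 1 : ℕ) : ℝ) + 1 = (b : ℝ) ^ l := by
    intro l
    rw [Nat.cast_sub (h1 l)]
    push_cast
    ring
  have hb0 : (b : ℝ) ≠ 0 := by positivity
  have h := log_le_sum_Ico_inv (Nat.sub_le_sub_right (Nat.pow_le_pow_right hb (Nat.le_succ l)) 1)
  rw [h2, h2] at h
  convert h using 2
  rw [Nat.succ_eq_add_one, pow_succ]
  field_simp

/-- All levels have a large expected size if each of the following is large: the mean number `r` of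
children in the next range, the gain `r ^ k * q₁` of a group, and the total gain of the chain. -/
theorem levelMean_lower (ν : PMF ℕ) (e : ℕ → ℕ) {k k' g : ℕ} (hk : 1 ≤ k) {r q₁ q₂ Y : ℝ}
    (hY : 1 ≤ Y) (hq₁ : 0 < q₁) (hq₂ : 0 < q₂)
    (hk₁ : q₁ ≤ (ν.toMeasure (Set.Ici k)).toReal) (hk₂ : q₂ ≤ (ν.toMeasure (Set.Ici k')).toReal)
    (he : ∀ l, r ≤ ∑ j ∈ Finset.Ico (e l) (e (l + 1)), ((j : ℝ) + 1)⁻¹)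
    (h₁ : Y ≤ r) (h₂ : Y ≤ r ^ k * q₁) (h₃ : Y ≤ (r ^ k * q₁) ^ g * (r * q₂))
    (i : ℕ) (hi1 : 1 ≤ i) (hi : i ≤ g * k + 1) :
    Y ≤ levelMean ν e (chainCars k k' g) i := by
  have hr1 : 1 ≤ r := hY.trans h₁
  have hr0 : 0 < r := by linarith
  have hlow : ∀ i ≤ g * k,
      (r ^ k * q₁) ^ (i / k) * r ^ (i % k) ≤ levelMean ν e (chainCars k k' g) i := by
    intro i hi
    -- `i / k` is the number of complete groups among the first `i` vertices of a chain
    have h : r ^ i * q₁ ^ (i / k) ≤ levelMean ν e (chainCars k k' g) i := by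
      induction i with
      | zero => simp [levelMean]
      | succ i ih =>
        rw [levelMean, Finset.prod_range_succ, ← levelMean, growth, chainCars,
          if_neg (by omega), Nat.succ_div]
        have h0 : 0 ≤ levelMean ν e (chainCars k k' g) i :=
          le_trans (by positivity) (ih (by omega))
        split_ifs with hd
        · calc r ^ (i + 1) * q₁ ^ (i / k + 1) = r ^ i * q₁ ^ (i / k) * (q₁ * r) := by ring
            _ ≤ _ := by
              gcongr
              · exact ih (by omega)
              · exact he i
        · have h1 : (ν.toMeasure (Set.Ici 0)).toReal = 1 := by
            have : Set.Ici 0 = (Set.univ : Set ℕ) := by ext; simp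
            rw [this, measure_univ, ENNReal.toReal_one]
          rw [h1, one_mul, add_zero]
          calc r ^ (i + 1) * q₁ ^ (i / k) = r ^ i * q₁ ^ (i / k) * r := by ring
            _ ≤ _ := by
              gcongr
              · exact ih (by omega)
              · exact he i
    refine le_trans (le_of_eq ?_) h
    calc (r ^ k * q₁) ^ (i / k) * r ^ (i % k) = r ^ (k * (i / k) + i % k) * q₁ ^ (i / k) := by
          rw [pow_add, mul_pow, pow_mul]
          ring
      _ = _ := by rw [Nat.div_add_mod]
  rcases Nat.lt_or_ge i (g * k + 1) with hlt | hge
  · refine le_trans ?_ (hlow i (by omega))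
    have hX : 1 ≤ r ^ k * q₁ := hY.trans h₂
    rcases Nat.eq_zero_or_pos (i / k) with h0 | hpos
    · have hmod : i % k ≠ 0 := by
        intro hm
        have := Nat.div_add_mod i k
        rw [h0, hm] at this
        omega
      rw [h0, pow_zero, one_mul]
      exact h₁.trans (le_self_pow₀ hr1 hmod)
    · calc Y ≤ r ^ k * q₁ := h₂
        _ ≤ (r ^ k * q₁) ^ (i / k) := le_self_pow₀ hX hpos.ne'
        _ ≤ _ := le_mul_of_one_le_right (by positivity) (one_le_pow₀ hr1)
  · obtain rfl : i = g * k + 1 := by omega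
    have hg := hlow (g * k) le_rfl
    rw [Nat.mul_div_cancel _ hk, Nat.mul_mod_left, pow_zero, mul_one] at hg
    rw [levelMean, Finset.prod_range_succ, ← levelMean, growth, chainCars, if_pos rfl]
    have h0 : 0 ≤ levelMean ν e (chainCars k k' g) (g * k) := le_trans (by positivity) hg
    refine h₃.trans ?_
    rw [mul_comm r q₂]
    have := he (g * k)
    gcongr

/-- A quantitative lower bound for the flux: with `r` proportional to `log n`, chains of `g * k + 1`
vertices with the prescribed numbers of cars exist in `R` disjoint ranges of vertices. -/
theorem parkingLaw_flux_lt_le (ν : PMF ℕ) {k k' g R n : ℕ} (hk : 1 ≤ k) (hk' : 2 ≤ k')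
    (hR : 1 ≤ R) {r q₁ q₂ Y : ℝ} (hr : r * (2 * (R * (g * k + 1) : ℕ)) = Real.log n)
    (hY : 1 ≤ Y) (hq₁ : 0 < q₁) (hq₂ : 0 < q₂)
    (hk₁ : q₁ ≤ (ν.toMeasure (Set.Ici k)).toReal) (hk₂ : q₂ ≤ (ν.toMeasure (Set.Ici k')).toReal)
    (h₁ : Y ≤ r) (h₂ : Y ≤ r ^ k * q₁) (h₃ : Y ≤ (r ^ k * q₁) ^ g * (r * q₂)) :
    parkingLaw ν {ω | ¬ R ≤ flux ω.1 n ω.2 + 1} ≤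
      ENNReal.ofReal ((R * (g * k + 1) : ℕ) / Y) := by
  set H := g * k + 1 with hH
  set J := R * H with hJ
  have hJ1 : 1 ≤ J := Nat.mul_pos hR (by omega)
  have hr1 : 1 ≤ r := hY.trans h₁
  have hY0 : 0 < Y := by linarith
  -- the ranges of vertices are delimited by the powers of `b`, and `b ^ J ≤ n`
  set b := ⌊Real.exp (2 * r)⌋₊ with hb
  have hexp : 2 ≤ Real.exp (2 * r) := by
    have := Real.add_one_le_exp (2 * r)
    linarith
  have hb1 : 1 ≤ b := Nat.le_floor (by push_cast; linarith)
  have hlogb : r ≤ Real.log b := by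
    have := le_log_floor_exp (show 2 ≤ 2 * r by linarith)
    rw [← hb] at this
    linarith
  have hn0 : 0 < n := by
    rcases Nat.eq_zero_or_pos n with rfl | h
    · have : 0 < r * (2 * (J : ℝ)) := by
        have : (1 : ℝ) ≤ J := by exact_mod_cast hJ1
        positivity
      simp at hr
      rcases hr with h | h <;> [linarith; omega]
    · exact h
  have hbn : b ^ J ≤ n := by
    have h1 : (b : ℝ) ^ J ≤ n := by
      calc (b : ℝ) ^ J ≤ Real.exp (2 * r) ^ J := by
            gcongr
            exact Nat.floor_le (Real.exp_pos _).le
        _ = Real.exp (Real.log n) := by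
            rw [← Real.exp_nat_mul, ← hr]
            congr 1
            ring
        _ = n := Real.exp_log (by exact_mod_cast hn0)
    exact_mod_cast h1
  set E : ℕ → ℕ := fun l => b ^ l - 1 with hE
  have hEmono : Monotone E := fun a c hac =>
    Nat.sub_le_sub_right (Nat.pow_le_pow_right hb1 hac) 1
  have hgrow : ∀ l, r ≤ ∑ j ∈ Finset.Ico (E l) (E (l + 1)), ((j : ℝ) + 1)⁻¹ := fun l =>
    hlogb.trans (log_le_sum_Ico_pow hb1 l)
  have hsub : {ω : Attachment × (ℕ → ℕ) | ¬ R ≤ flux ω.1 n ω.2 + 1} ⊆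
      ⋃ m ∈ Finset.range R, {ω | level (fun i => E (m * H + i)) (chainCars k k' g) H ω = ∅} := by
    intro ω hω
    by_contra hcon
    simp only [Set.mem_iUnion, Finset.mem_range, not_exists] at hcon
    refine hω (le_flux_of_level_nonempty hEmono (chainCars k k' g) H ?_ ω R n ?_
      fun m hm h => hcon m hm h)
    · rw [hH, sum_chainCars hk]
      omega
    · have : 1 ≤ b ^ (R * H) := Nat.one_le_pow _ _ hb1
      rw [hJ] at hbn
      simp only [hE]
      omega
  have hone : ∀ m, parkingLaw ν
      {ω | level (fun i => E (m * H + i)) (chainCars k k' g) H ω = ∅} ≤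
        ENNReal.ofReal (H / Y) := by
    intro m
    have hlow := levelMean_lower ν (fun i => E (m * H + i)) (k' := k') (g := g) hk hY hq₁ hq₂
      hk₁ hk₂ (fun l => hgrow (m * H + l)) h₁ h₂ h₃
    refine (parkingLaw_level_empty_le ν (fun a c hac => hEmono (by omega)) _ H ?_).trans ?_
    · intro l _
      refine mul_pos ?_ ((by linarith : 0 < r).trans_le (hgrow (m * H + l)))
      rw [chainCars]
      split_ifs
      · exact hq₂.trans_le hk₂
      · exact hq₁.trans_le hk₁
      · have : Set.Ici 0 = (Set.univ : Set ℕ) := by ext; simp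
        rw [this, measure_univ, ENNReal.toReal_one]
        exact one_pos
    · refine ENNReal.ofReal_le_ofReal ?_
      calc _ ≤ ∑ _l ∈ Finset.range H, Y⁻¹ := by
            refine Finset.sum_le_sum fun l hl => ?_
            have hl' := Finset.mem_range.1 hl
            exact inv_anti₀ hY0 (hlow (l + 1) (by omega) (by omega))
        _ = _ := by
            rw [Finset.sum_const, Finset.card_range, nsmul_eq_mul, div_eq_mul_inv]
  calc _ ≤ ∑ m ∈ Finset.range R, parkingLaw ν
        {ω | level (fun i => E (m * H + i)) (chainCars k k' g) H ω = ∅} :=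
        (measure_mono hsub).trans (measure_biUnion_finset_le _ _)
    _ ≤ ∑ _m ∈ Finset.range R, ENNReal.ofReal (H / Y) := Finset.sum_le_sum fun m _ => hone m
    _ = _ := by
        rw [Finset.sum_const, Finset.card_range, nsmul_eq_mul, ← ENNReal.ofReal_natCast,
          ← ENNReal.ofReal_mul (by positivity), hJ]
        congr 1
        push_cast
        ring

/-! ### Consequences of the assumptions on the arrivals -/

namespace IsArrivalFamily

variable {μ : ℝ → PMF ℕ} {K : ℕ} {C β : ℕ → ℝ}

theorem apply_eq_zero_of_lt (hμ : IsArrivalFamily μ K C β) {α : ℝ} (hα : α ∈ Set.Icc (0 : ℝ) 1)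
    {k : ℕ} (hk : K < k) : μ α k = 0 := by
  have h := (PMF.toMeasure_apply_eq_one_iff _ MeasurableSet.of_discrete).1 (hμ.bounded α hα)
  by_contra hne
  have := h ((PMF.mem_support_iff _ _).2 hne)
  simp only [Set.mem_Iic] at this
  omega

theorem zero_apply_eq_zero (hμ : IsArrivalFamily μ K C β) {k : ℕ} (hk : k ≠ 0) :
    μ 0 k = 0 := by
  have h := hμ.mean 0 (by simp)
  rw [ENNReal.ofReal_zero, ENNReal.tsum_eq_zero] at h
  simpa [hk] using h k

theorem exists_two_le (hμ : IsArrivalFamily μ K C β) : ∃ k, 2 ≤ k ∧ k ≤ K ∧ 0 < C k := by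
  by_contra! hcon
  have h1 : ∀ k ∈ Finset.Icc 2 K, ∀ᶠ α in 𝓝[>] (0 : ℝ), μ α k = 0 := by
    intro k hk
    have hk' := Finset.mem_Icc.1 hk
    rcases hμ.asymp k (by omega) hk'.2 with h | h
    · exact h.2
    · exact absurd h.1 (hcon k hk'.1 hk'.2).not_gt
  have h2 : ∀ᶠ α in 𝓝[>] (0 : ℝ), α ∈ Set.Ioc (0 : ℝ) 1 := Ioc_mem_nhdsGT one_pos
  obtain ⟨α, hα, hα1⟩ := (((Finset.eventually_all _).2 h1).and h2).exists
  refine (hμ.nontrivial α hα1).ne ?_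
  rw [PMF.toMeasure_apply_eq_one_iff _ MeasurableSet.of_discrete]
  intro k hk
  rw [PMF.mem_support_iff] at hk
  by_contra hk01
  simp only [Set.mem_insert_iff, Set.mem_singleton_iff, not_or] at hk01
  rcases Nat.lt_or_ge K k with h | h
  · exact hk (hμ.apply_eq_zero_of_lt (Set.Ioc_subset_Icc_self hα1) h)
  · exact hk (hα k (Finset.mem_Icc.2 ⟨by omega, h⟩))

theorem finite_index (K : ℕ) (C : ℕ → ℝ) : {k : ℕ | 1 ≤ k ∧ k ≤ K ∧ 0 < C k}.Finite :=
  (Set.finite_Icc 1 K).subset fun _ hk => ⟨hk.1, hk.2.1⟩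

theorem exists_eq_betaStar (hμ : IsArrivalFamily μ K C β) :
    ∃ k, 1 ≤ k ∧ k ≤ K ∧ 0 < C k ∧ β k = betaStar K C β := by
  obtain ⟨k, hk2, hkK, hC⟩ := hμ.exists_two_le
  have hne : (β '' {k : ℕ | 1 ≤ k ∧ k ≤ K ∧ 0 < C k}).Nonempty :=
    ⟨β k, k, ⟨by omega, hkK, hC⟩, rfl⟩
  obtain ⟨k, ⟨h1, h2, h3⟩, h⟩ := hne.csInf_mem ((finite_index K C).image β)
  exact ⟨k, h1, h2, h3, h⟩

theorem betaStar_le {k : ℕ} (h1 : 1 ≤ k) (hK : k ≤ K) (hC : 0 < C k) :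
    betaStar K C β ≤ β k :=
  csInf_le ((finite_index K C).image β).bddBelow ⟨k, ⟨h1, hK, hC⟩, rfl⟩

theorem asymp_of_pos (hμ : IsArrivalFamily μ K C β) {k : ℕ} (h1 : 1 ≤ k) (hK : k ≤ K)
    (hC : 0 < C k) : 1 / (k : ℝ) ≤ β k ∧
      (fun α : ℝ => (μ α k).toReal) ~[𝓝[>] (0 : ℝ)] fun α : ℝ => C k * α ^ (β k * (k : ℝ)) := by
  rcases hμ.asymp k h1 hK with h | h
  · exact absurd h.1 hC.ne'
  · exact h.2

theorem betaStar_pos (hμ : IsArrivalFamily μ K C β) : 0 < betaStar K C β := by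
  obtain ⟨k, h1, hK, hC, hβ⟩ := hμ.exists_eq_betaStar
  rw [← hβ]
  refine lt_of_lt_of_le ?_ (hμ.asymp_of_pos h1 hK hC).1
  have : (0 : ℝ) < k := by exact_mod_cast h1
  positivity

theorem exists_eventually_apply_le (hμ : IsArrivalFamily μ K C β) (k : ℕ) :
    ∃ B : ℝ, 0 ≤ B ∧ (1 ≤ k → k ≤ K →
      ∀ᶠ α in 𝓝[>] (0 : ℝ), (μ α k).toReal ≤ B * (α ^ betaStar K C β) ^ k) := by
  by_cases hk : 1 ≤ k ∧ k ≤ K ∧ 0 < C k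
  · obtain ⟨h1, hK, hC⟩ := hk
    obtain ⟨c, hc0, hc⟩ := (hμ.asymp_of_pos h1 hK hC).2.isBigO.exists_nonneg
    refine ⟨c * C k, by positivity, fun _ _ => ?_⟩
    filter_upwards [hc.bound, Ioc_mem_nhdsGT (one_pos : (0 : ℝ) < 1)] with α hα hα1
    have hp : 0 ≤ α ^ (β k * (k : ℝ)) := Real.rpow_nonneg hα1.1.le _
    rw [Real.norm_of_nonneg ENNReal.toReal_nonneg, Real.norm_of_nonneg (by positivity)] at hα
    refine hα.trans ?_
    rw [mul_assoc, ← Real.rpow_natCast, ← Real.rpow_mul hα1.1.le]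
    have := Real.rpow_le_rpow_of_exponent_ge hα1.1 hα1.2
      (mul_le_mul_of_nonneg_right (betaStar_le (β := β) h1 hK hC) (Nat.cast_nonneg k))
    gcongr
  · refine ⟨0, le_rfl, fun h1 hK => ?_⟩
    rcases hμ.asymp k h1 hK with h | h
    · filter_upwards [h.2] with α hα
      simp [hα]
    · exact absurd ⟨h1, hK, h.1⟩ hk

theorem exists_eventually_le_tail (hμ : IsArrivalFamily μ K C β) {k : ℕ} (h1 : 1 ≤ k)
    (hK : k ≤ K) (hC : 0 < C k) : ∃ s : ℝ, 0 < s ∧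
      ∀ᶠ α in 𝓝[>] (0 : ℝ), s * α ^ (β k * (k : ℝ)) ≤ ((μ α).toMeasure (Set.Ici k)).toReal := by
  obtain ⟨c, hc0, hc⟩ := (hμ.asymp_of_pos h1 hK hC).2.symm.isBigO.exists_pos
  refine ⟨C k / c, by positivity, ?_⟩
  filter_upwards [hc.bound, self_mem_nhdsWithin] with α hα hα0
  have hα0' : 0 < α := hα0
  have hp : 0 ≤ α ^ (β k * (k : ℝ)) := Real.rpow_nonneg hα0'.le _
  rw [Real.norm_of_nonneg ENNReal.toReal_nonneg, Real.norm_of_nonneg (by positivity)] at hα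
  have h2 : (μ α k).toReal ≤ ((μ α).toMeasure (Set.Ici k)).toReal := by
    refine ENNReal.toReal_mono (measure_ne_top _ _) ?_
    rw [← PMF.toMeasure_apply_singleton _ _ (measurableSet_singleton k)]
    exact measure_mono (by simp)
  refine le_trans ?_ h2
  rw [div_mul_eq_mul_div, div_le_iff₀ hc0]
  linarith

/-- For small `α`, the generating function of `μ α` is bounded on `[0, α ^ (-β*)]`. -/
theorem exists_generating_le (hμ : IsArrivalFamily μ K C β) :
    ∃ A : ℝ, 1 ≤ A ∧ ∃ α₀ : ℝ, 0 < α₀ ∧ α₀ ≤ 1 ∧ ∀ α ∈ Set.Icc (0 : ℝ) α₀, ∀ z : ℝ, 0 ≤ z →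
      z * α ^ betaStar K C β ≤ 1 →
        ∑' k, μ α k * ENNReal.ofReal z ^ k ≤ ENNReal.ofReal A := by
  choose B hB0 hB using hμ.exists_eventually_apply_le
  have hev : ∀ᶠ α in 𝓝[>] (0 : ℝ), ∀ k ∈ Finset.Icc 1 K,
      (μ α k).toReal ≤ B k * (α ^ betaStar K C β) ^ k :=
    (Finset.eventually_all _).2 fun k hk => hB k (Finset.mem_Icc.1 hk).1 (Finset.mem_Icc.1 hk).2
  obtain ⟨u, hu0, hu⟩ := mem_nhdsGT_iff_exists_Ioc_subset.1 hev
  have hu0' : 0 < u := hu0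
  refine ⟨∑ k ∈ Finset.range (K + 1), (B k + 1), ?_, min u 1, by positivity, min_le_right _ _, ?_⟩
  · rw [Finset.sum_range_succ']
    have : 0 ≤ ∑ k ∈ Finset.range K, (B (k + 1) + 1) :=
      Finset.sum_nonneg fun k _ => by linarith [hB0 (k + 1)]
    linarith [hB0 0]
  · intro α hα z hz hzα
    have hα1 : α ∈ Set.Icc (0 : ℝ) 1 := ⟨hα.1, hα.2.trans (min_le_right _ _)⟩
    rw [tsum_eq_sum (s := Finset.range (K + 1)), ENNReal.ofReal_sum_of_nonneg]
    · refine Finset.sum_le_sum fun k hk => ?_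
      have hkK := Finset.mem_range.1 hk
      rcases Nat.eq_zero_or_pos k with rfl | hk0
      · rw [pow_zero, mul_one]
        refine (PMF.coe_le_one _ _).trans ?_
        rw [ENNReal.one_le_ofReal]
        linarith [hB0 0]
      rcases hα.1.eq_or_lt with rfl | hα0
      · simp [hμ.zero_apply_eq_zero hk0.ne']
      have h := hu ⟨hα0, hα.2.trans (min_le_left _ _)⟩ k (Finset.mem_Icc.2 ⟨hk0, by omega⟩)
      rw [← ENNReal.ofReal_toReal (PMF.apply_ne_top (μ α) k), ← ENNReal.ofReal_pow hz,
        ← ENNReal.ofReal_mul ENNReal.toReal_nonneg]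
      refine ENNReal.ofReal_le_ofReal ?_
      have hp : 0 ≤ α ^ betaStar K C β := Real.rpow_nonneg hα.1 _
      calc (μ α k).toReal * z ^ k ≤ B k * (α ^ betaStar K C β) ^ k * z ^ k := by gcongr
        _ = B k * (z * α ^ betaStar K C β) ^ k := by ring
        _ ≤ B k * 1 := by
            gcongr
            · exact hB0 k
            · exact pow_le_one₀ (by positivity) hzα
        _ ≤ B k + 1 := by linarith
    · exact fun k _ => by linarith [hB0 k]
    · intro k hk
      rw [hμ.apply_eq_zero_of_lt hα1 (by simpa using hk), zero_mul]

/-- Below the critical window a flux is unlikely. -/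
theorem exists_flux_pos_le (hμ : IsArrivalFamily μ K C β) :
    ∃ A : ℝ, 1 ≤ A ∧ ∃ α₀ : ℝ, 0 < α₀ ∧ α₀ ≤ 1 ∧ ∀ α ∈ Set.Icc (0 : ℝ) α₀, ∀ n : ℕ,
      1 ≤ Real.log n → 4 * A * Real.log n * α ^ betaStar K C β ≤ 1 →
        parkingLaw (μ α) {ω | 0 < flux ω.1 n ω.2} ≤ ENNReal.ofReal ((Real.log n ^ 2)⁻¹) := by
  obtain ⟨A, hA, α₀, h0, h1, hgen⟩ := hμ.exists_generating_le
  refine ⟨A, hA, α₀, h0, h1, fun α hα n hn hz => ?_⟩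
  set L := Real.log n with hL
  have hA0 : 0 < A := by linarith
  have hL0 : 0 < L := by linarith
  -- with this `z` the ratio of the geometric series is at most `2 * L * A / z = 1 / 2`
  set z : ℝ := 4 * A * L with hzdef
  have hz1 : 1 ≤ z := by nlinarith [mul_le_mul hA hn zero_le_one hA0.le]
  have hz0 : 0 < z := by linarith
  obtain ⟨m, rfl⟩ : ∃ m, n = m + 1 := by
    refine ⟨n - 1, ?_⟩
    have : n ≠ 0 := by
      rintro rfl
      simp [hL] at hn
      linarith
    omega
  have hH : ∑ v ∈ Finset.range m, ((v + 1 : ℕ) : ℝ≥0∞)⁻¹ ≤ ENNReal.ofReal (2 * L) := by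
    have h2 : ∑ v ∈ Finset.range m, ((v + 1 : ℕ) : ℝ≥0∞)⁻¹ =
        ENNReal.ofReal (∑ v ∈ Finset.range m, ((v + 1 : ℕ) : ℝ)⁻¹) := by
      rw [ENNReal.ofReal_sum_of_nonneg fun _ _ => by positivity]
      refine Finset.sum_congr rfl fun v _ => ?_
      rw [ENNReal.ofReal_inv_of_pos (by positivity), ENNReal.ofReal_natCast]
    rw [h2]
    refine ENNReal.ofReal_le_ofReal ?_
    have h3 := harmonic_le_one_add_log (m + 1)
    rw [harmonic_succ] at h3
    simp only [harmonic] at h3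
    push_cast at h3 ⊢
    have h4 : (0 : ℝ) ≤ ((m : ℝ) + 1)⁻¹ := by positivity
    rw [hL] at hn ⊢
    push_cast at hn ⊢
    linarith
  have hG := hgen α hα z hz0.le hz
  refine (parkingLaw_flux_pos_le (μ α) (ENNReal.ofReal z) (ENNReal.one_le_ofReal.2 hz1)
    ENNReal.ofReal_ne_top m).trans ?_
  set G := ∑' k, μ α k * ENNReal.ofReal z ^ k
  have hratio : (∑ v ∈ Finset.range m, ((v + 1 : ℕ) : ℝ≥0∞)⁻¹) * G * (ENNReal.ofReal z)⁻¹ ≤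
      ENNReal.ofReal (1 / 2) := by
    calc _ ≤ ENNReal.ofReal (2 * L) * ENNReal.ofReal A * (ENNReal.ofReal z)⁻¹ := by gcongr
      _ = ENNReal.ofReal (1 / 2) := by
        rw [← ENNReal.ofReal_inv_of_pos hz0, ← ENNReal.ofReal_mul (by positivity),
          ← ENNReal.ofReal_mul (by positivity), hzdef]
        congr 1
        field_simp
        norm_num
  calc _ ≤ ENNReal.ofReal A * (ENNReal.ofReal z)⁻¹ ^ 2 * (1 - ENNReal.ofReal (1 / 2))⁻¹ := by
        gcongr
    _ = ENNReal.ofReal (A * (z⁻¹) ^ 2 * (1 - 1 / 2)⁻¹) := by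
        rw [← ENNReal.ofReal_inv_of_pos hz0, ← ENNReal.ofReal_one,
          ← ENNReal.ofReal_sub _ (by norm_num),
          ← ENNReal.ofReal_inv_of_pos (show (0 : ℝ) < 1 - 1 / 2 by norm_num),
          ← ENNReal.ofReal_pow (by positivity), ← ENNReal.ofReal_mul (by positivity),
          ← ENNReal.ofReal_mul (by positivity)]
    _ ≤ _ := by
        refine ENNReal.ofReal_le_ofReal ?_
        have h8 : A * (z⁻¹) ^ 2 * (1 - 1 / 2)⁻¹ = (8 * A)⁻¹ * (L ^ 2)⁻¹ := by
          rw [hzdef]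
          field_simp
          norm_num
        rw [h8]
        refine mul_le_of_le_one_left (by positivity) (inv_le_one_of_one_le₀ (by linarith))

/-- Above the critical window a large flux is likely, for all laws that dominate `μ α`. -/
theorem exists_flux_lt_le (hμ : IsArrivalFamily μ K C β) {δ : ℝ} (hδ : 0 < δ) {R : ℕ}
    (hR : 1 ≤ R) {η : ℝ} (hη : 0 < η) :
    ∃ α₀ : ℝ, 0 < α₀ ∧ α₀ ≤ 1 ∧ ∀ α ∈ Set.Ioc (0 : ℝ) α₀, ∀ ν : PMF ℕ,
      (∀ k, (μ α).toMeasure (Set.Ici k) ≤ ν.toMeasure (Set.Ici k)) → ∀ n : ℕ,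
        α ^ (-(betaStar K C β + δ)) ≤ Real.log n →
          parkingLaw ν {ω | ¬ R ≤ flux ω.1 n ω.2 + 1} ≤ ENNReal.ofReal η := by
  obtain ⟨k, hk1, hkK, hCk, hβk⟩ := hμ.exists_eq_betaStar
  obtain ⟨k', hk'2, hk'K, hCk'⟩ := hμ.exists_two_le
  obtain ⟨s₁, hs₁, hev₁⟩ := hμ.exists_eventually_le_tail hk1 hkK hCk
  obtain ⟨s₂, hs₂, hev₂⟩ := hμ.exists_eventually_le_tail (by omega) hk'K hCk'
  have hb := hμ.betaStar_pos
  rw [hβk] at hev₁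
  set b := betaStar K C β
  set B := β k' * (k' : ℝ)
  have hk0 : (0 : ℝ) < k := by exact_mod_cast hk1
  -- each group of `k` vertices gains a factor `α ^ (-δ * k)`, and `g` groups compensate `α ^ B`
  obtain ⟨g, hg⟩ := exists_nat_ge (B / (δ * k))
  rw [div_le_iff₀ (by positivity)] at hg
  set J : ℕ := R * (g * k + 1) with hJ
  have hJ0 : 0 < J := Nat.mul_pos hR (by omega)
  have hJ0' : (0 : ℝ) < J := by exact_mod_cast hJ0
  set Y : ℝ := max 1 (J / η) with hY
  set κ : ℝ := (2 * (J : ℝ))⁻¹ with hκ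
  have hκ0 : 0 < κ := by positivity
  have hlim : ∀ (a y : ℝ), 0 < a → y < 0 → ∀ᶠ α in 𝓝[>] (0 : ℝ), Y ≤ a * α ^ y := by
    intro a y ha hy
    exact ((tendsto_rpow_neg_nhdsGT_zero hy).const_mul_atTop ha).eventually_ge_atTop Y
  have e₁ := hlim κ (-(b + δ)) hκ0 (by linarith)
  have e₂ := hlim (κ ^ k * s₁) (-(δ * k)) (by positivity) (by
    have : 0 < δ * k := by positivity
    linarith)
  have e₃ := hlim ((κ ^ k * s₁) ^ g * (κ * s₂)) (-(δ * k) * g + (-(b + δ) + B)) (by positivity)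
    (by nlinarith)
  obtain ⟨u, hu0, hu⟩ := mem_nhdsGT_iff_exists_Ioc_subset.1
    (hev₁.and (hev₂.and (e₁.and (e₂.and e₃))))
  have hu0' : 0 < u := hu0
  refine ⟨min u 1, by positivity, min_le_right _ _, fun α hα ν hν n hn => ?_⟩
  have hα0 : 0 < α := hα.1
  obtain ⟨h1, h2, h3, h4, h5⟩ := hu ⟨hα.1, hα.2.trans (min_le_left _ _)⟩
  have hνr : ∀ k, ((μ α).toMeasure (Set.Ici k)).toReal ≤ (ν.toMeasure (Set.Ici k)).toReal :=
    fun k => ENNReal.toReal_mono (measure_ne_top _ _) (hν k)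
  set r₀ := κ * α ^ (-(b + δ)) with hr₀
  have hr₀0 : 0 < r₀ := by positivity
  have hr : r₀ ≤ κ * Real.log n := by rw [hr₀]; gcongr
  have h4' : r₀ ^ k * (s₁ * α ^ (b * (k : ℝ))) = κ ^ k * s₁ * α ^ (-(δ * k)) := by
    rw [hr₀, mul_pow, ← Real.rpow_natCast (α ^ (-(b + δ))), ← Real.rpow_mul hα0.le,
      show -(δ * k) = -(b + δ) * (k : ℝ) + b * (k : ℝ) by ring, Real.rpow_add hα0]
    ring
  have h5' : (κ ^ k * s₁ * α ^ (-(δ * k))) ^ g * (r₀ * (s₂ * α ^ B)) =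
      (κ ^ k * s₁) ^ g * (κ * s₂) * α ^ (-(δ * k) * g + (-(b + δ) + B)) := by
    rw [hr₀, mul_pow (κ ^ k * s₁), ← Real.rpow_natCast (α ^ (-(δ * k))),
      ← Real.rpow_mul hα0.le, Real.rpow_add hα0, Real.rpow_add hα0]
    ring
  refine (parkingLaw_flux_lt_le ν (g := g) (n := n) (r := κ * Real.log n) (Y := Y)
    (q₁ := s₁ * α ^ (b * (k : ℝ))) (q₂ := s₂ * α ^ B) hk1 hk'2 hR ?_ (le_max_left _ _)
    (by positivity) (by positivity) (h1.trans (hνr k)) (h2.trans (hνr k')) (h3.trans hr)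
    ?_ ?_).trans ?_
  · rw [← hJ, hκ]
    field_simp
  · calc Y ≤ r₀ ^ k * (s₁ * α ^ (b * (k : ℝ))) := by rw [h4']; exact h4
      _ ≤ _ := by gcongr
  · calc Y ≤ (r₀ ^ k * (s₁ * α ^ (b * (k : ℝ)))) ^ g * (r₀ * (s₂ * α ^ B)) := by
          rw [h4', h5']; exact h5
      _ ≤ _ := by gcongr
  · refine ENNReal.ofReal_le_ofReal ?_
    rw [← hJ, div_le_iff₀ (lt_of_lt_of_le one_pos (le_max_left _ _))]
    have := le_max_right 1 ((J : ℝ) / η)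
    rw [div_le_iff₀ hη] at this
    linarith

end IsArrivalFamily

/-! ### The appearance time -/

theorem logLog_le {θ : ℕ∞} {y : ℝ} (hy : 0 < y)
    (h : (θ : ℝ≥0∞) ≤ ENNReal.ofReal (Real.exp y)) : logLog θ ≤ (Real.log y : EReal) := by
  have h1 := EReal.toENNReal_le_toENNReal (ENNReal.log_monotone h)
  rw [ENNReal.log_ofReal_of_pos (Real.exp_pos y), Real.log_exp, EReal.real_coe_toENNReal] at h1
  have h2 := ENNReal.log_monotone h1
  rwa [ENNReal.log_ofReal_of_pos hy] at h2

theorem le_logLog {θ : ℕ∞} {y : ℝ} (hy : 0 < y)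
    (h : ENNReal.ofReal (Real.exp y) ≤ (θ : ℝ≥0∞)) : (Real.log y : EReal) ≤ logLog θ := by
  have h1 := EReal.toENNReal_le_toENNReal (ENNReal.log_monotone h)
  rw [ENNReal.log_ofReal_of_pos (Real.exp_pos y), Real.log_exp, EReal.real_coe_toENNReal] at h1
  have h2 := ENNReal.log_monotone h1
  rwa [ENNReal.log_ofReal_of_pos hy] at h2

theorem logLog_appearanceTime_le {t : Attachment} {x : ℕ → ℕ} {c y : ℝ} (hy : 0 < y)
    (h : c ≤ (flux t ⌊Real.exp y⌋₊ x : ℝ)) :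
    logLog (appearanceTime t x c) ≤ (Real.log y : EReal) := by
  refine logLog_le hy ?_
  have h1 : appearanceTime t x c ≤ (⌊Real.exp y⌋₊ : ℕ∞) := sInf_le ⟨_, h, rfl⟩
  calc ((appearanceTime t x c : ℕ∞) : ℝ≥0∞) ≤ ((⌊Real.exp y⌋₊ : ℕ∞) : ℝ≥0∞) := by
        exact_mod_cast h1
    _ = ENNReal.ofReal (⌊Real.exp y⌋₊ : ℝ) := by simp
    _ ≤ _ := ENNReal.ofReal_le_ofReal (Nat.floor_le (Real.exp_pos y).le)

theorem le_logLog_appearanceTime {t : Attachment} {x : ℕ → ℕ} {c y : ℝ} (hy : 0 < y)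
    (h : ¬ c ≤ (flux t ⌊Real.exp y⌋₊ x : ℝ)) :
    (Real.log y : EReal) ≤ logLog (appearanceTime t x c) := by
  refine le_logLog hy ?_
  have h1 : ((⌊Real.exp y⌋₊ + 1 : ℕ) : ℕ∞) ≤ appearanceTime t x c := by
    refine le_sInf ?_
    rintro _ ⟨n, hn, rfl⟩
    by_contra hlt
    simp only [Nat.cast_le, not_le] at hlt
    refine h (le_trans hn ?_)
    exact_mod_cast flux_mono t x (Nat.lt_succ_iff.1 hlt)
  calc ENNReal.ofReal (Real.exp y) ≤ ENNReal.ofReal ((⌊Real.exp y⌋₊ + 1 : ℕ) : ℝ) := by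
        refine ENNReal.ofReal_le_ofReal ?_
        push_cast
        exact (Nat.lt_floor_add_one _).le
    _ = (((⌊Real.exp y⌋₊ + 1 : ℕ) : ℕ∞) : ℝ≥0∞) := by
        rw [ENNReal.ofReal_natCast]
        simp
    _ ≤ _ := by exact_mod_cast h1

/-! ### Limits in probability -/

theorem tendsto_parkingLaw_flux_ge {ι : Type*} {l : Filter ι} {ν : ι → PMF ℕ} {n : ι → ℕ}
    (h : ∀ R : ℕ, 1 ≤ R → ∀ η : ℝ, 0 < η → ∀ᶠ i in l,
      parkingLaw (ν i) {ω | ¬ R ≤ flux ω.1 (n i) ω.2 + 1} ≤ ENNReal.ofReal η) (M : ℝ) :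
    Tendsto (fun i => parkingLaw (ν i) {ω | M ≤ (flux ω.1 (n i) ω.2 : ℝ)}) l (𝓝 1) := by
  set R := ⌈M⌉₊ + 1 with hR
  have h0 : Tendsto (fun i => parkingLaw (ν i) {ω | ¬ R ≤ flux ω.1 (n i) ω.2 + 1}) l (𝓝 0) := by
    rw [ENNReal.tendsto_nhds_zero]
    intro ε hε
    rcases eq_or_ne ε ∞ with rfl | hε'
    · simp
    · have := h R (by omega) ε.toReal (ENNReal.toReal_pos hε.ne' hε')
      rwa [ENNReal.ofReal_toReal hε'] at this
  have h1 := ENNReal.Tendsto.sub (tendsto_const_nhds (x := (1 : ℝ≥0∞)) (f := l)) h0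
    (Or.inl ENNReal.one_ne_top)
  rw [tsub_zero] at h1
  refine tendsto_of_tendsto_of_tendsto_of_le_of_le h1 tendsto_const_nhds (fun i => ?_)
    fun i => prob_le_one
  rw [tsub_le_iff_right, ← measure_univ (μ := parkingLaw (ν i))]
  refine (measure_mono fun ω _ => ?_).trans (measure_union_le _ _)
  by_cases hω : R ≤ flux ω.1 (n i) ω.2 + 1
  · have hceil : ⌈M⌉₊ ≤ flux ω.1 (n i) ω.2 := by omega
    exact Or.inl (Nat.ceil_le.1 hceil)
  · exact Or.inr hω

theorem tendsto_log_natCast_atTop : Tendsto (fun n : ℕ => Real.log n) atTop atTop :=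
  Real.tendsto_log_atTop.comp tendsto_natCast_atTop_atTop

namespace IsArrivalFamily

variable {μ : ℝ → PMF ℕ} {K : ℕ} {C β : ℕ → ℝ}

theorem tendsto_flux_zero (hμ : IsArrivalFamily μ K C β) (a : ℕ → ℝ)
    (ha : ∀ n, a n ∈ Set.Icc (0 : ℝ) 1)
    (hao : a =o[atTop] (fun n : ℕ => Real.log n ^ (-1 / betaStar K C β))) {ε : ℝ} (hε : 0 < ε) :
    Tendsto (fun n : ℕ => parkingLaw (μ (a n)) {ω | ε ≤ (flux ω.1 n ω.2 : ℝ)}) atTop (𝓝 0) := by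
  obtain ⟨A, hA, α₀, h0, -, hbound⟩ := hμ.exists_flux_pos_le
  have hb := hμ.betaStar_pos
  set b := betaStar K C β
  have hA0 : 0 < A := by linarith
  set d : ℝ := ((4 * A)⁻¹) ^ b⁻¹ with hd
  have hd0 : 0 < d := by positivity
  have hL := tendsto_log_natCast_atTop
  have hlim : Tendsto (fun n : ℕ => ENNReal.ofReal ((Real.log n ^ 2)⁻¹)) atTop (𝓝 0) := by
    rw [← ENNReal.ofReal_zero]
    exact ENNReal.tendsto_ofReal
      (tendsto_inv_atTop_zero.comp ((tendsto_pow_atTop two_ne_zero).comp hL))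
  refine tendsto_of_tendsto_of_tendsto_of_le_of_le' tendsto_const_nhds hlim
    (Eventually.of_forall fun _ => zero_le) ?_
  filter_upwards [hao.bound (lt_min hd0 h0), hL.eventually_ge_atTop 1] with n hn hn1
  have hn0 : 0 < Real.log n := by linarith
  have hrpow0 : 0 < Real.log n ^ (-1 / b) := Real.rpow_pos_of_pos hn0 _
  rw [Real.norm_of_nonneg (ha n).1, Real.norm_of_nonneg hrpow0.le] at hn
  have hrpow1 : Real.log n ^ (-1 / b) ≤ 1 :=
    Real.rpow_le_one_of_one_le_of_nonpos hn1 (div_nonpos_of_nonpos_of_nonneg (by norm_num) hb.le)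
  have h1 : a n ≤ α₀ := by
    calc a n ≤ min d α₀ * Real.log n ^ (-1 / b) := hn
      _ ≤ α₀ * 1 := by gcongr; exact min_le_right _ _
      _ = α₀ := mul_one _
  have h2 : 4 * A * Real.log n * a n ^ b ≤ 1 := by
    calc 4 * A * Real.log n * a n ^ b
        ≤ 4 * A * Real.log n * (d * Real.log n ^ (-1 / b)) ^ b := by
          have := (ha n).1
          gcongr
          exact hn.trans (by gcongr; exact min_le_left _ _)
      _ = 4 * A * Real.log n * ((4 * A)⁻¹ * (Real.log n)⁻¹) := by
          rw [Real.mul_rpow hd0.le hrpow0.le, hd, ← Real.rpow_mul (by positivity),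
            ← Real.rpow_mul hn0.le, inv_mul_cancel₀ hb.ne', div_mul_cancel₀ _ hb.ne',
            Real.rpow_one, Real.rpow_neg_one]
      _ = 1 := by field_simp
  refine (measure_mono fun ω hω => ?_).trans (hbound (a n) ⟨(ha n).1, h1⟩ n hn1 h2)
  have h3 : (0 : ℝ) < flux ω.1 n ω.2 := hε.trans_le hω
  exact_mod_cast h3

theorem tendsto_flux_infinite (hμ : IsArrivalFamily μ K C β) {δ : ℝ} (hδ : 0 < δ) (a : ℕ → ℝ)
    (ha : ∀ n, a n ∈ Set.Icc (0 : ℝ) 1)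
    (hao : (fun n : ℕ => Real.log n ^ (-1 / betaStar K C β + δ)) =o[atTop] a) (M : ℝ) :
    Tendsto (fun n : ℕ => parkingLaw (μ (a n)) {ω | M ≤ (flux ω.1 n ω.2 : ℝ)}) atTop (𝓝 1) := by
  have hb := hμ.betaStar_pos
  set b := betaStar K C β
  -- a smaller `δ` keeps the exponent negative, so that the comparison density tends to `0`
  set s : ℝ := max (1 / b - δ) (1 / (2 * b)) with hs
  have hs0 : 0 < s := lt_of_lt_of_le (by positivity) (le_max_right _ _)
  have hsb : s < 1 / b := by
    refine max_lt (by linarith) ?_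
    exact one_div_lt_one_div_of_lt hb (by linarith)
  have hδ' : 0 < 1 / s - b := by
    rw [sub_pos, lt_one_div hb hs0]
    exact hsb
  have hL := tendsto_log_natCast_atTop
  have hlim : Tendsto (fun n : ℕ => Real.log n ^ (-s)) atTop (𝓝 0) :=
    (tendsto_rpow_neg_atTop hs0).comp hL
  refine tendsto_parkingLaw_flux_ge (fun R hR η hη => ?_) M
  obtain ⟨α₀, h0, h1, hbound⟩ := hμ.exists_flux_lt_le hδ' hR hη
  filter_upwards [hao.bound one_pos, hL.eventually_ge_atTop 1, hlim.eventually_lt_const h0]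
    with n hn hn1 hnα
  have hn0 : 0 < Real.log n := by linarith
  rw [one_mul, Real.norm_of_nonneg (ha n).1,
    Real.norm_of_nonneg (Real.rpow_nonneg hn0.le _)] at hn
  have hα0 : 0 < Real.log n ^ (-s) := Real.rpow_pos_of_pos hn0 _
  have hle : Real.log n ^ (-s) ≤ a n := by
    refine le_trans (Real.rpow_le_rpow_of_exponent_le hn1 ?_) hn
    have := le_max_left (1 / b - δ) (1 / (2 * b))
    rw [neg_div]
    linarith
  refine hbound _ ⟨hα0, hnα.le⟩ _ (fun k => hμ.mono _ ⟨hα0.le, hnα.le.trans h1⟩ _ (ha n) hle k)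
    n (le_of_eq ?_)
  rw [← Real.rpow_mul hn0.le]
  have : -s * -(b + (1 / s - b)) = 1 := by field_simp; ring
  rw [this, Real.rpow_one]

/-- At the sizes `exp (α ^ (-y))` with `y < β*` there is no flux. -/
theorem tendsto_flux_floor_zero (hμ : IsArrivalFamily μ K C β) {y : ℝ} (hy0 : 0 < y)
    (hy : y < betaStar K C β) {c : ℝ} (hc : 0 < c) :
    Tendsto (fun α : ℝ => parkingLaw (μ α)
      {ω | c ≤ (flux ω.1 ⌊Real.exp (α ^ (-y))⌋₊ ω.2 : ℝ)}) (𝓝[>] (0 : ℝ)) (𝓝 0) := by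
  obtain ⟨A, hA, α₀, h0, -, hbound⟩ := hμ.exists_flux_pos_le
  set b := betaStar K C β
  have hY : Tendsto (fun α : ℝ => α ^ (-y)) (𝓝[>] (0 : ℝ)) atTop :=
    tendsto_rpow_neg_nhdsGT_zero (by linarith)
  have hlim : Tendsto (fun α : ℝ => ENNReal.ofReal (((α ^ (-y) / 2) ^ 2)⁻¹))
      (𝓝[>] (0 : ℝ)) (𝓝 0) := by
    rw [← ENNReal.ofReal_zero]
    exact ENNReal.tendsto_ofReal (tendsto_inv_atTop_zero.comp
      ((tendsto_pow_atTop two_ne_zero).comp (hY.atTop_div_const two_pos)))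
  have hcond : Tendsto (fun α : ℝ => 4 * A * α ^ (b - y)) (𝓝[>] (0 : ℝ)) (𝓝 0) := by
    have h := (Real.continuousAt_rpow_const 0 (b - y) (Or.inr (by linarith))).tendsto.const_mul
      (4 * A)
    rw [Real.zero_rpow (by linarith), mul_zero] at h
    exact h.mono_left nhdsWithin_le_nhds
  refine tendsto_of_tendsto_of_tendsto_of_le_of_le' tendsto_const_nhds hlim
    (Eventually.of_forall fun _ => zero_le) ?_
  filter_upwards [hY.eventually_ge_atTop 2, hcond.eventually_lt_const one_pos,
    Ioc_mem_nhdsGT h0] with α hα2 hα1 hα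
  have hlog := le_log_floor_exp hα2
  have hlog' : Real.log ⌊Real.exp (α ^ (-y))⌋₊ ≤ α ^ (-y) := by
    have h1 : 0 < (⌊Real.exp (α ^ (-y))⌋₊ : ℝ) := by
      have := Real.add_one_le_exp (α ^ (-y))
      exact_mod_cast Nat.floor_pos.2 (by linarith)
    rw [Real.log_le_iff_le_exp h1]
    exact Nat.floor_le (Real.exp_pos _).le
  have h2 : 4 * A * Real.log ⌊Real.exp (α ^ (-y))⌋₊ * α ^ b ≤ 1 := by
    have hαb : 0 ≤ α ^ b := Real.rpow_nonneg hα.1.le _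
    calc _ ≤ 4 * A * α ^ (-y) * α ^ b := by gcongr
      _ = 4 * A * α ^ (b - y) := by
        rw [mul_assoc, ← Real.rpow_add hα.1]
        congr 2
        ring
      _ ≤ 1 := hα1.le
  refine (measure_mono fun ω hω => ?_).trans
    ((hbound α ⟨hα.1.le, hα.2⟩ _ (by linarith) h2).trans (ENNReal.ofReal_le_ofReal ?_))
  · have h3 : (0 : ℝ) < flux ω.1 ⌊Real.exp (α ^ (-y))⌋₊ ω.2 := hc.trans_le hω
    exact_mod_cast h3
  · have : 0 < α ^ (-y) / 2 := by linarith
    gcongr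

/-- At the sizes `exp (α ^ (-y))` with `y > β*` the flux is arbitrarily large. -/
theorem tendsto_flux_floor_one (hμ : IsArrivalFamily μ K C β) {y : ℝ}
    (hy : betaStar K C β < y) (c : ℝ) :
    Tendsto (fun α : ℝ => parkingLaw (μ α)
      {ω | c ≤ (flux ω.1 ⌊Real.exp (α ^ (-y))⌋₊ ω.2 : ℝ)}) (𝓝[>] (0 : ℝ)) (𝓝 1) := by
  have hb := hμ.betaStar_pos
  set b := betaStar K C β
  have hY : Tendsto (fun α : ℝ => α ^ (-y)) (𝓝[>] (0 : ℝ)) atTop :=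
    tendsto_rpow_neg_nhdsGT_zero (by linarith)
  have hZ : Tendsto (fun α : ℝ => α ^ (-((y - b) / 2))) (𝓝[>] (0 : ℝ)) atTop :=
    tendsto_rpow_neg_nhdsGT_zero (by linarith)
  refine tendsto_parkingLaw_flux_ge (fun R hR η hη => ?_) c
  obtain ⟨α₀, h0, h1, hbound⟩ := hμ.exists_flux_lt_le (show 0 < (y - b) / 2 by linarith) hR hη
  filter_upwards [hY.eventually_ge_atTop 2, hZ.eventually_ge_atTop 2, Ioc_mem_nhdsGT h0]
    with α hα2 hαZ hα
  refine hbound α hα (μ α) (fun k => le_rfl) _ (le_trans ?_ (le_log_floor_exp hα2))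
  have h2 : α ^ (-y) = α ^ (-(b + (y - b) / 2)) * α ^ (-((y - b) / 2)) := by
    rw [← Real.rpow_add hα.1]
    congr 1
    ring
  have h3 : 0 < α ^ (-(b + (y - b) / 2)) := Real.rpow_pos_of_pos hα.1 _
  rw [h2]
  nlinarith

theorem tendsto_logLog_appearanceTime (hμ : IsArrivalFamily μ K C β) {c : ℝ} (hc : 0 < c)
    {ε : ℝ} (hε : 0 < ε) :
    Tendsto (fun α : ℝ => parkingLaw (μ α)
      {ω | ((betaStar K C β - ε : ℝ) : EReal) <
            logLog (appearanceTime ω.1 ω.2 c) / ((|Real.log α| : ℝ) : EReal) ∧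
          logLog (appearanceTime ω.1 ω.2 c) / ((|Real.log α| : ℝ) : EReal) <
            ((betaStar K C β + ε : ℝ) : EReal)})
      (𝓝[>] (0 : ℝ)) (𝓝 1) := by
  have hb := hμ.betaStar_pos
  set b := betaStar K C β
  -- the exponents at which the two regimes are applied; the lower one is positive
  set y₁ : ℝ := max (b - ε / 2) (b / 2) with hy₁
  have hy₁0 : 0 < y₁ := lt_of_lt_of_le (by linarith) (le_max_right _ _)
  have hy₁b : y₁ < b := max_lt (by linarith) (by linarith)
  have hy₁ε : b - ε < y₁ := lt_of_lt_of_le (by linarith) (le_max_left _ _)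
  set y₂ : ℝ := b + ε / 2 with hy₂
  have hsub := ENNReal.Tendsto.sub (hμ.tendsto_flux_floor_one (show b < y₂ by linarith) c)
    (hμ.tendsto_flux_floor_zero hy₁0 hy₁b hc) (Or.inl ENNReal.one_ne_top)
  rw [tsub_zero] at hsub
  refine tendsto_of_tendsto_of_tendsto_of_le_of_le' hsub tendsto_const_nhds ?_
    (Eventually.of_forall fun α => prob_le_one)
  filter_upwards [Ioo_mem_nhdsGT (one_pos : (0 : ℝ) < 1)] with α hα
  rw [tsub_le_iff_right]
  refine (measure_mono fun ω hω => ?_).trans (measure_union_le _ _)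
  by_cases hω' : c ≤ (flux ω.1 ⌊Real.exp (α ^ (-y₁))⌋₊ ω.2 : ℝ)
  · exact Or.inr hω'
  have hlogneg : Real.log α < 0 := Real.log_neg hα.1 hα.2
  have habs : 0 < |Real.log α| := abs_pos.2 hlogneg.ne
  have hlog : ∀ y : ℝ, Real.log (α ^ (-y)) = y * |Real.log α| := by
    intro y
    rw [Real.log_rpow hα.1, abs_of_neg hlogneg]
    ring
  have hdiv : ∀ y : ℝ, ((Real.log (α ^ (-y)) : ℝ) : EReal) / ((|Real.log α| : ℝ) : EReal) =
      (y : EReal) := by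
    intro y
    rw [hlog, ← EReal.coe_div, mul_div_cancel_right₀ _ habs.ne']
  have habs' : (0 : EReal) ≤ ((|Real.log α| : ℝ) : EReal) := by exact_mod_cast habs.le
  refine Or.inl ⟨?_, ?_⟩
  · have h := EReal.div_le_div_right_of_nonneg habs'
      (le_logLog_appearanceTime (Real.rpow_pos_of_pos hα.1 _) hω')
    rw [hdiv] at h
    exact lt_of_lt_of_le (by exact_mod_cast hy₁ε) h
  · have h := EReal.div_le_div_right_of_nonneg habs'
      (logLog_appearanceTime_le (Real.rpow_pos_of_pos hα.1 _) hω)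
    rw [hdiv] at h
    refine lt_of_le_of_lt h ?_
    exact_mod_cast (show y₂ < b + ε by linarith)

end IsArrivalFamily

end Parking

theorem mainTheorem1 (μ : ℝ → PMF ℕ) (K : ℕ) (C β : ℕ → ℝ)
    (hμ : Parking.IsArrivalFamily μ K C β) :
    -- no flux below the critical window
    (∀ a : ℕ → ℝ, (∀ n, a n ∈ Set.Icc (0 : ℝ) 1) →
      a =o[atTop] (fun n : ℕ => Real.log n ^ (-1 / Parking.betaStar K C β)) →
      ∀ ε : ℝ, 0 < ε →
        Tendsto (fun n : ℕ => Parking.parkingLaw (μ (a n))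
          {ω | ε ≤ (Parking.flux ω.1 n ω.2 : ℝ)}) atTop (𝓝 0)) ∧
    -- infinite flux above the critical window
    (∀ δ : ℝ, 0 < δ → ∀ a : ℕ → ℝ, (∀ n, a n ∈ Set.Icc (0 : ℝ) 1) →
      (fun n : ℕ => Real.log n ^ (-1 / Parking.betaStar K C β + δ)) =o[atTop] a →
      ∀ M : ℝ,
        Tendsto (fun n : ℕ => Parking.parkingLaw (μ (a n))
          {ω | M ≤ (Parking.flux ω.1 n ω.2 : ℝ)}) atTop (𝓝 1)) ∧
    -- the time of appearance of the flux
    (∀ c : ℝ, 0 < c → ∀ ε : ℝ, 0 < ε →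
      Tendsto (fun α : ℝ => Parking.parkingLaw (μ α)
        {ω | ((Parking.betaStar K C β - ε : ℝ) : EReal) <
              Parking.logLog (Parking.appearanceTime ω.1 ω.2 c) / ((|Real.log α| : ℝ) : EReal) ∧
            Parking.logLog (Parking.appearanceTime ω.1 ω.2 c) / ((|Real.log α| : ℝ) : EReal) <
              ((Parking.betaStar K C β + ε : ℝ) : EReal)})
        (𝓝[>] (0 : ℝ)) (𝓝 1)) := by
  exact ⟨fun a ha hao _ hε => hμ.tendsto_flux_zero a ha hao hε,
    fun _ hδ a ha hao M => hμ.tendsto_flux_infinite hδ a ha hao M,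
    fun _ hc _ hε => hμ.tendsto_logLog_appearanceTime hc hε⟩
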